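/- **Problem.** Jobs $J_1,\dots,J_n$ have positive integer processing times $p_j$ and weights $w_j$, with $p_1/w_1\le\dots\le p_n/w_n$. Write $P_j=\sum_{i\le j}p_i$, $P=P_n$, $W=\sum_j w_j$, $w_{\max}=\max_j w_j$, $p_{\min}=\min_j p_j$. The original schedule $\pi^*$ processes $J_1,\dots,J_n$ in this order without idling from time $0$, so $C_j(\pi^*)=P_j$ and $S_j(\pi^*)=P_{j-1}$. A single machine is unavailable during $[T_1,T_2]$, where $0\le T_1<T_2$ are integers, and $k$ is a nonnegative integer. A feasible schedule $\sigma$ assigns to every job a starting time $S_j(\sigma)\ge 0$ (real), with $C_j(\sigma)=S_j(\sigma)+p_j$, such that the jobs are processed non-preemptively one at a time, each job has $C_j(\sigma)\le T_1$ or $S_j(\sigma)\ge T_2$, and $\Delta_{\max}=\max_j|C_j(\sigma)-C_j(\pi^*)|\le k$. The problem $(1,h_1\mid\Delta_{\max}\le k\mid\sum w_jC_j)$ asks for a feasible schedule minimizing $\sum_j w_jC_j(\sigma)$. Let $j_1=\min\{j: P_j>T_1\}$ and $j_3=\max\{j:P_j-k\le T_1\}$ ($0$ if there is no such $j$), and assume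 $p_{\min}\le T_1<P$ and $T_2-P_{j_1-1}\le k$. **Algorithm $\mathrm{Approx}(a,\epsilon)$.** Let $\delta=1+\epsilon/(2n)$. A quadruple $(j;\ell^1,\ell^2;Z)$ describes a partial schedule of $J_1,\dots,J_j$, where $\ell^1,\ell^2$ are the last completion times before $T_1$ and after $T_2$, and $Z$ is the total weighted completion time. For each $j$, quadruples are kept in boxes, at most one per box: the ranges $\{0\}\cup[p_{\min},T_1]$ of $\ell^1$, $[T_2+p_a,T_2+P]$ of $\ell^2$ and $[\sum_{i<a}w_iP_i+w_a(T_2+p_a),\ \sum_i w_iP_i+WT_2]$ of $Z$ are each cut into intervals $[L,L\delta],(L\delta,L\delta^2],\dots$, where $L$ is the lower (positive) bound, and into $\{0\}$ for $\ell^1$; a box is a product of three such intervals. When two quadruples fall into one box, the one with the smaller $\ell^1$ is kept. Start with $(a;P_{a-1},T_2+p_a;\sum_{i<a}w_iP_i+w_a(T_2+p_a))$: $J_1,\dots,J_{a-1}$ are processed from time $0$ and $J_a$ from time $T_2$. For $j=a,\dots,j_3-1$, from every kept quadruple $(j;\ell^1,\ell^2;Z)$ generate: (1) the one in which $J_{j+1}$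 starts at $\ell^2$; (2) if $\ell^1+p_{j+1}\le T_1$ and $P_{j+1}-(\ell^1+p_{j+1})\le k$, the one in which $J_{j+1}$ starts at $\ell^1$; (3) if $\ell^1+p_{j+1}<P_{j+1}-k\le T_1$, the full schedule in which $J_{j+1},\dots,J_{j_3}$ are processed consecutively from time $P_j-k$ and $J_{j_3+1},\dots,J_n$ consecutively from time $\ell^2$. Complete every kept quadruple with $j=\max(a,j_3)$ by processing $J_{j+1},\dots,J_n$ consecutively from time $\ell^2$. All full schedules are kept in boxes by the same rule, and the kept one with the smallest $Z$ is the result. **Algorithm $\mathrm{Approx}(\epsilon)$.** Run $\mathrm{Approx}(a,\epsilon)$ for all $a\in\{1,\dots,j_1\}$ with $T_2-P_{a-1}\le k$ and return the schedule with the smallest total weighted completion time among the results. **Corollary 4.1.** For $0<\epsilon\le 1$, $\mathrm{Approx}(\epsilon)$ is a $(1+\epsilon)$-approximation for $(1,h_1\mid\Delta_{\max}\le k\mid\sum w_jC_j)$: it returns a feasible schedule whose total weighted completion time is at most $(1+\epsilon)$ times that of every feasible schedule. Its running time, where each arithmetic operation (including logarithm and rounding), comparison and memory access takes one step, is $$O\!\left(\frac{n^5}{\epsilon^3}\,\log\max(T_1,2)\,\log(T_2+P)\,\log(w_{\max}P+WT_2)\right),$$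 with an absolute implied constant. -/

import Mathlib

noncomputable section

namespace Resched

/-! ## The rescheduling problem -/

/-- The data of an instance: jobs `J_1, …, J_n` (only the values of `p` and `w` at `1, …, n`
matter) with processing times `p j` and weights `w j`, the machine unavailability interval
`[T₁, T₂]`, and the bound `k` on the maximum time deviation. -/
structure Problem where
  n : ℕ
  p : ℕ → ℕ
  w : ℕ → ℕ
  T₁ : ℕ
  T₂ : ℕ
  k : ℕ

namespace Problem

variable (I : Problem)

/-- The indices of the jobs. -/
def jobs : Finset ℕ := Finset.Icc 1 I.n

/-- Starting time of `J_j` in the original schedule `π* = (1, 2, …, n)`. -/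
def planStart (j : ℕ) : ℕ := ∑ i ∈ Finset.Ico 1 j, I.p i

/-- Completion time of `J_j` in the original schedule `π*`. -/
def planCompl (j : ℕ) : ℕ := I.planStart j + I.p j

/-- `P`, the total processing time. -/
def totalP : ℕ := ∑ j ∈ I.jobs, I.p j

/-- `W`, the total weight. -/
def totalW : ℕ := ∑ j ∈ I.jobs, I.w j

/-- `w_max`, the largest weight. -/
def wMax : ℕ := I.jobs.sup I.w

/-- `p_min`, the smallest processing time. -/
def pMin : ℕ := sInf (I.p '' {j | j ∈ I.jobs})

/-- The index of the first job that `π*` completes strictly after `T₁`. -/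
def firstHit : ℕ := sInf {j | j ∈ I.jobs ∧ I.T₁ < I.planCompl j}

/-- The standing assumptions on an instance: positive integer data, jobs numbered in the
weighted-shortest-processing-time order, `T₁ < T₂`, and the non-triviality conditions
`p_min ≤ T₁ < P` and `T₂ - S_{j₁}(π*) ≤ k`, where `j₁ = firstHit`. -/
structure Valid : Prop where
  p_pos : ∀ j ∈ I.jobs, 0 < I.p j
  w_pos : ∀ j ∈ I.jobs, 0 < I.w j
  wspt : ∀ i ∈ I.jobs, ∀ j ∈ I.jobs, i ≤ j → (I.p i : ℚ) / I.w i ≤ (I.p j : ℚ) / I.w j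
  T₁_lt_T₂ : I.T₁ < I.T₂
  pMin_le : I.pMin ≤ I.T₁
  T₁_lt_P : I.T₁ < I.totalP
  dev_le : (I.T₂ : ℤ) - I.planStart I.firstHit ≤ I.k

/-- A schedule is given by the (real) starting times of the jobs; only its values at
`1, …, n` matter.  It is feasible if jobs start at nonnegative times and are processed without
preemption one at a time, no job is processed during `[T₁, T₂]`, and every job completes within
`k` time units of its completion time in `π*` (that is, `Δ_max ≤ k`). -/
structure Feasible (σ : ℕ → ℝ) : Prop where
  nonneg : ∀ j ∈ I.jobs, 0 ≤ σ j
  disjoint : ∀ i ∈ I.jobs, ∀ j ∈ I.jobs, i ≠ j → σ i + I.p i ≤ σ j ∨ σ j + I.p j ≤ σ i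
  available : ∀ j ∈ I.jobs, σ j + I.p j ≤ I.T₁ ∨ (I.T₂ : ℝ) ≤ σ j
  dev_le : ∀ j ∈ I.jobs, |(σ j + I.p j) - I.planCompl j| ≤ I.k

/-- The objective `∑ w_j C_j`. -/
def objective (σ : ℕ → ℝ) : ℝ := ∑ j ∈ I.jobs, (I.w j : ℝ) * (σ j + I.p j)

end Problem

/-! ## Step counting

`Timed α` is a computation with a result and the number of elementary steps it has used.  Every
arithmetic operation on integers or reals (including `log`, rounding and conversion), every
comparison, every array access, and every extension of a linked list is one step; creating an array
takes one step per cell; a loop takes one step per iteration in addition to its body, and one to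
stop.  Sequencing adds the numbers of steps.  Branching on a truth value or an array cell that has
been obtained by a counted step, and grouping values into records, is not counted again. -/

structure Timed (α : Type) where
  val : α
  steps : ℕ

instance : Monad Timed where
  pure x := ⟨x, 0⟩
  bind x f := ⟨(f x.val).val, x.steps + (f x.val).steps⟩

def addN (x y : ℕ) : Timed ℕ := ⟨x + y, 1⟩
def subN (x y : ℕ) : Timed ℕ := ⟨x - y, 1⟩
def mulN (x y : ℕ) : Timed ℕ := ⟨x * y, 1⟩
def maxN (x y : ℕ) : Timed ℕ := ⟨max x y, 1⟩
def minN (x y : ℕ) : Timed ℕ := ⟨min x y, 1⟩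
def leN (x y : ℕ) : Timed Bool := ⟨decide (x ≤ y), 1⟩
def ltN (x y : ℕ) : Timed Bool := ⟨decide (x < y), 1⟩
def eqN (x y : ℕ) : Timed Bool := ⟨decide (x = y), 1⟩
def toR (x : ℕ) : Timed ℝ := ⟨(x : ℝ), 1⟩
def addR (x y : ℝ) : Timed ℝ := ⟨x + y, 1⟩
def mulR (x y : ℝ) : Timed ℝ := ⟨x * y, 1⟩
def divR (x y : ℝ) : Timed ℝ := ⟨x / y, 1⟩
def logR (x : ℝ) : Timed ℝ := ⟨Real.log x, 1⟩
def floorR (x : ℝ) : Timed ℕ := ⟨⌊x⌋₊, 1⟩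
def ceilR (x : ℝ) : Timed ℕ := ⟨⌈x⌉₊, 1⟩

/-- Prepending to a linked list (the old list is shared, not copied). -/
def consL {α : Type} (x : α) (l : List α) : Timed (List α) := ⟨x :: l, 1⟩

/-- An array of natural numbers with `size` cells, all equal to zero. -/
def newArr (size : ℕ) : Timed (ℕ → ℕ) := ⟨fun _ => 0, size⟩
def readA (A : ℕ → ℕ) (i : ℕ) : Timed ℕ := ⟨A i, 1⟩
def writeA (A : ℕ → ℕ) (i x : ℕ) : Timed (ℕ → ℕ) := ⟨Function.update A i x, 1⟩

def loop {s : Type} (body : ℕ → s → Timed s) : ℕ → ℕ → s → Timed s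
  | 0, _, x => ⟨x, 1⟩
  | c + 1, i, x => do
    let i' ← addN i 1
    let x' ← body i x
    loop body c i' x'

/-- `for i = lo, …, hi do x := body i x`, starting from `x = init`. -/
def forRange {s : Type} (lo hi : ℕ) (init : s) (body : ℕ → s → Timed s) : Timed s :=
  loop body (hi + 1 - lo) lo init

/-! ## The algorithm -/

/-- What is computed once for the instance: the arrays `P_j = p_1 + … + p_j`,
`W_j = w_1 + … + w_j` and `Z_j = w_1 P_1 + … + w_j P_j`, the minimum `p_min`, the first index `j₁`
with `C_j(π*) > T₁`, and the last index `j₃` with `C_j(π*) - k ≤ T₁` (`0` if there is none). -/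
structure Prep where
  P : ℕ → ℕ
  W : ℕ → ℕ
  Z : ℕ → ℕ
  pmin : ℕ
  j₁ : ℕ
  j₃ : ℕ

def preprocess (I : Problem) : Timed Prep := do
  let size ← addN I.n 1
  let P₀ ← newArr size
  let W₀ ← newArr size
  let Z₀ ← newArr size
  let m₀ ← readA I.p 1
  let bound ← addN I.T₁ I.k
  forRange 1 I.n (⟨P₀, W₀, Z₀, m₀, 0, 0⟩ : Prep) fun i d => do
    let pi ← readA I.p i
    let wi ← readA I.w i
    let i' ← subN i 1
    let P' ← readA d.P i'
    let Pi ← addN P' pi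
    let PA ← writeA d.P i Pi
    let W' ← readA d.W i'
    let Wi ← addN W' wi
    let WA ← writeA d.W i Wi
    let Z' ← readA d.Z i'
    let wP ← mulN wi Pi
    let Zi ← addN Z' wP
    let ZA ← writeA d.Z i Zi
    let m ← minN d.pmin pi
    let unset ← eqN d.j₁ 0
    let late ← ltN I.T₁ Pi
    let early ← leN Pi bound
    pure ⟨PA, WA, ZA, m, if unset && late then i else d.j₁, if early then i else d.j₃⟩

/-- The total weighted completion time of `J_{i+1}, …, J_j` processed consecutively from time `t`
on, computed from the prefix sums. -/
def segment (d : Prep) (i j t : ℕ) : Timed ℕ := do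
  let Zj ← readA d.Z j
  let Zi ← readA d.Z i
  let Wj ← readA d.W j
  let Wi ← readA d.W i
  let Pi ← readA d.P i
  let dz ← subN Zj Zi
  let dw ← subN Wj Wi
  let c ← mulN Pi dw
  let z ← subN dz c
  let e ← mulN dw t
  addN z e

/-- A partial schedule on `J_1, …, J_j`, described by the quadruple `(j; ℓ¹, ℓ²; Z)`: `l1` and `l2`
are the maximum completion times in the earlier and in the later schedule, `Z` is the total weighted
completion time.  For backtracking, `blocks` records the schedule, the last block first: a block
`(m, t)` says that the jobs from the one after the preceding block (or from `J_1`) up to `J_m` are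
processed consecutively from time `t` on. -/
structure Quad where
  j : ℕ
  l1 : ℕ
  l2 : ℕ
  Z : ℕ
  blocks : List (ℕ × ℕ)

/-- A family of boxes, indexed by `(i₁, i₂, i₃)`; each is empty or holds one quadruple. -/
abbrev Boxes := ℕ × ℕ × ℕ → Option Quad

/-- The subdivision into boxes: `log δ`, the lower bounds `L^i`, and
`r_i = ⌊log_δ (U^i / L^i)⌋`. -/
structure Grid where
  logδ : ℝ
  L₁ : ℕ
  L₂ : ℕ
  L₃ : ℕ
  r₁ : ℕ
  r₂ : ℕ
  r₃ : ℕ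

/-- `⌊log_δ (U / L)⌋`. -/
def logRatio (logδ : ℝ) (L U : ℕ) : Timed ℕ := do
  let u ← toR U
  let l ← toR L
  let q ← divR u l
  let g ← logR q
  let h ← divR g logδ
  floorR h

/-- The index `i` of the interval that contains `x`, where the interval of index `0` is `[0, 0]`, that
of index `1` is `[L, L δ]`, and that of index `i ≥ 2` is `(L δ^(i-1), L δ^i]` (which is to be cut off
at the upper bound `U` for the last index `⌊log_δ (U / L)⌋ + 1`). -/
def boxIndex (logδ : ℝ) (L x : ℕ) : Timed ℕ := do
  let isZero ← eqN x 0
  if isZero then pure 0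
  else do
    let y ← toR x
    let l ← toR L
    let q ← divR y l
    let g ← logR q
    let h ← divR g logδ
    let c ← ceilR h
    maxN 1 c

def emptyBoxes (g : Grid) : Timed Boxes :=
  ⟨fun _ => none, (g.r₁ + 2) * (g.r₂ + 1) * (g.r₃ + 1)⟩

def readBox (B : Boxes) (b : ℕ × ℕ × ℕ) : Timed (Option Quad) := ⟨B b, 1⟩

def writeBox (B : Boxes) (b : ℕ × ℕ × ℕ) (q : Quad) : Timed Boxes :=
  ⟨Function.update B b (some q), 1⟩

/-- Saves a quadruple in its box; in an occupied box the one with the smaller `ℓ¹` survives. -/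
def save (g : Grid) (B : Boxes) (q : Quad) : Timed Boxes := do
  let i₁ ← boxIndex g.logδ g.L₁ q.l1
  let i₂ ← boxIndex g.logδ g.L₂ q.l2
  let i₃ ← boxIndex g.logδ g.L₃ q.Z
  let old ← readBox B (i₁, i₂, i₃)
  match old with
  | none => writeBox B (i₁, i₂, i₃) q
  | some q' => do
    let smaller ← ltN q.l1 q'.l1
    if smaller then writeBox B (i₁, i₂, i₃) q else pure B

/-- Runs over the non-empty boxes of `B`. -/
def forBoxes {s : Type} (g : Grid) (B : Boxes) (init : s) (body : Quad → s → Timed s) :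
    Timed s := do
  let e₁ ← addN g.r₁ 1
  let e₂ ← addN g.r₂ 1
  let e₃ ← addN g.r₃ 1
  forRange 0 e₁ init fun i₁ x₁ =>
    forRange 1 e₂ x₁ fun i₂ x₂ =>
      forRange 1 e₃ x₂ fun i₃ x₃ => do
        let c ← readBox B (i₁, i₂, i₃)
        match c with
        | none => pure x₃
        | some q => body q x₃

/-- Case 1: `J_{j+1}` is appended to the later schedule. -/
def addLater (I : Problem) (g : Grid) (q : Quad) (B : Boxes) : Timed Boxes := do
  let j' ← addN q.j 1
  let pj ← readA I.p j'
  let wj ← readA I.w j'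
  let C ← addN q.l2 pj
  let wC ← mulN wj C
  let Z' ← addN q.Z wC
  let bl ← consL (j', q.l2) q.blocks
  save g B ⟨j', q.l1, C, Z', bl⟩

/-- Case 2: `J_{j+1}` is appended to the earlier schedule without idle time, if
`ℓ¹ + p_{j+1} ≤ T₁` and `C_{j+1}(π*) - (ℓ¹ + p_{j+1}) ≤ k`. -/
def addEarlier (I : Problem) (d : Prep) (g : Grid) (q : Quad) (B : Boxes) : Timed Boxes := do
  let j' ← addN q.j 1
  let pj ← readA I.p j'
  let wj ← readA I.w j'
  let C ← addN q.l1 pj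
  let Pj ← readA d.P j'
  let Ck ← addN C I.k
  let fits ← leN C I.T₁
  let close ← leN Pj Ck
  if fits && close then do
    let wC ← mulN wj C
    let Z' ← addN q.Z wC
    let bl ← consL (j', q.l1) q.blocks
    save g B ⟨j', C, q.l2, Z', bl⟩
  else pure B

/-- Case 3: if `ℓ¹ + p_{j+1} < C_{j+1}(π*) - k ≤ T₁`, the jobs `J_{j+1}, …, J_{j₃}` are processed
consecutively in the earlier schedule from time `C_{j+1}(π*) - p_{j+1} - k = P_j - k` on, and the
jobs after `J_{j₃}` in the later schedule from time `ℓ²` on. -/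
def addIdle (I : Problem) (d : Prep) (g : Grid) (q : Quad) (B : Boxes) : Timed Boxes := do
  let j' ← addN q.j 1
  let pj ← readA I.p j'
  let C ← addN q.l1 pj
  let Ck ← addN C I.k
  let Pj' ← readA d.P j'
  let Tk ← addN I.T₁ I.k
  let gap ← ltN Ck Pj'
  let fits ← leN Pj' Tk
  if gap && fits then do
    let Pj ← readA d.P q.j
    let t ← subN Pj I.k
    let za ← segment d q.j d.j₃ t
    let zb ← segment d d.j₃ I.n q.l2
    let z₁ ← addN q.Z za
    let z₂ ← addN z₁ zb
    let Pa ← readA d.P d.j₃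
    let Pn ← readA d.P I.n
    let l1' ← subN Pa I.k
    let dp ← subN Pn Pa
    let l2' ← addN q.l2 dp
    let b₁ ← consL (d.j₃, t) q.blocks
    let b₂ ← consL (I.n, q.l2) b₁
    save g B ⟨I.n, l1', l2', z₂, b₂⟩
  else pure B

/-- Completes a partial schedule by processing all remaining jobs in the later schedule. -/
def complete (I : Problem) (d : Prep) (g : Grid) (q : Quad) (B : Boxes) : Timed Boxes := do
  let z ← segment d q.j I.n q.l2
  let Z' ← addN q.Z z
  let Pn ← readA d.P I.n
  let Pj ← readA d.P q.j
  let dp ← subN Pn Pj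
  let l2' ← addN q.l2 dp
  let bl ← consL (I.n, q.l2) q.blocks
  save g B ⟨I.n, q.l1, l2', Z', bl⟩

/-- The one with the smaller `Z`. -/
def better (q : Quad) : Option Quad → Timed (Option Quad)
  | none => pure (some q)
  | some q' => do
    let smaller ← ltN q.Z q'.Z
    if smaller then pure (some q) else pure (some q')

/-- Step 1 of `Approx(a, ε)`: `δ = 1 + ε / (2 n)` and the subdivisions of `[p_min, T₁]`,
`[T₂ + p_a, T₂ + P]` and `[Z(J_1, …, J_{a-1}) + w_a (T₂ + p_a), Z(J_1, …, J_n) + W T₂]`. -/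
def makeGrid (I : Problem) (d : Prep) (ε : ℝ) (a : ℕ) : Timed Grid := do
  let nr ← toR I.n
  let n2 ← mulR 2 nr
  let x ← divR ε n2
  let δ ← addR 1 x
  let logδ ← logR δ
  let a' ← subN a 1
  let pa ← readA I.p a
  let wa ← readA I.w a
  let Za' ← readA d.Z a'
  let Zn ← readA d.Z I.n
  let Wn ← readA d.W I.n
  let Pn ← readA d.P I.n
  let L₂ ← addN I.T₂ pa
  let U₂ ← addN I.T₂ Pn
  let wC ← mulN wa L₂
  let L₃ ← addN Za' wC
  let WT ← mulN Wn I.T₂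
  let U₃ ← addN Zn WT
  let r₁ ← logRatio logδ d.pmin I.T₁
  let r₂ ← logRatio logδ L₂ U₂
  let r₃ ← logRatio logδ L₃ U₃
  pure ⟨logδ, d.pmin, L₂, L₃, r₁, r₂, r₃⟩

/-- The partial schedule that processes `J_1, …, J_{a-1}` from time `0` and `J_a` from time `T₂` on. -/
def startQuad (I : Problem) (d : Prep) (a : ℕ) : Timed Quad := do
  let a' ← subN a 1
  let pa ← readA I.p a
  let wa ← readA I.w a
  let Pa' ← readA d.P a'
  let Za' ← readA d.Z a'
  let C ← addN I.T₂ pa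
  let wC ← mulN wa C
  let Z' ← addN Za' wC
  let b₁ ← consL (a', 0) []
  let b₂ ← consL (a, I.T₂) b₁
  pure ⟨a, Pa', C, Z', b₂⟩

/-- Algorithm `Approx(a, ε)`: sparse dynamic programming over the boxes, for the schedules in which
`J_a` starts at time `T₂`.  In the loop, the state consists of the boxes of the current `j` and of
those of full schedules; the result is the full schedule found that has the smallest `Z`. -/
def approxAt (I : Problem) (d : Prep) (ε : ℝ) (a : ℕ) : Timed (Option Quad) := do
  let g ← makeGrid I d ε a
  let cur₀ ← emptyBoxes g
  let full₀ ← emptyBoxes g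
  let q₀ ← startQuad I d a
  let curA ← save g cur₀ q₀
  let last ← subN d.j₃ 1
  let st ← forRange a last (curA, full₀) fun _ st => do
    let next₀ ← emptyBoxes g
    forBoxes g st.1 (next₀, st.2) fun q nf => do
      let next₁ ← addLater I g q nf.1
      let next₂ ← addEarlier I d g q next₁
      let full₁ ← addIdle I d g q nf.2
      pure (next₂, full₁)
  let full ← forBoxes g st.1 st.2 fun q f => complete I d g q f
  forBoxes g full (none : Option Quad) fun q best => better q best

/-- Index of the last job of a list of blocks. -/
def lastJob : List (ℕ × ℕ) → Timed ℕ
  | [] => ⟨0, 1⟩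
  | b :: _ => ⟨b.1, 1⟩

/-- Backtracking: writes the starting times described by a list of blocks into an array. -/
def backtrack (I : Problem) : List (ℕ × ℕ) → (ℕ → ℕ) → Timed (ℕ → ℕ)
  | [], A => ⟨A, 1⟩
  | b :: rest, A => do
    let m ← lastJob rest
    let lo ← addN m 1
    let r ← forRange lo b.1 (A, b.2) fun i At => do
      let A' ← writeA At.1 i At.2
      let pi ← readA I.p i
      let t' ← addN At.2 pi
      pure (A', t')
    backtrack I rest r.1

/-- Algorithm `Approx(ε)`: calls `Approx(a, ε)` for all `a = 1, …, j₁` with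
`Δ_a = T₂ - S_a(π*) ≤ k`, and returns the best full schedule found (its array of starting times). -/
def approx (I : Problem) (ε : ℝ) : Timed (Option (ℕ → ℕ)) := do
  let d ← preprocess I
  let best ← forRange 1 d.j₁ (none : Option Quad) fun a best => do
    let a' ← subN a 1
    let Sa ← readA d.P a'
    let Sk ← addN Sa I.k
    let ok ← leN I.T₂ Sk
    if ok then do
      let res ← approxAt I d ε a
      match res with
      | none => pure best
      | some q => better q best
    else pure best
  match best with
  | none => pure none
  | some q => do
    let size ← addN I.n 1
    let A ← newArr size
    let σ ← backtrack I q.blocks A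
    pure (some σ)

end Resched

end

namespace Resched

open Finset

/-! ### Values and costs of timed computations -/

section Timed

variable {α β s : Type}

/-! No structure theorem for optimal schedules is needed. From a feasible `τ` only the set `L` of
late jobs (those starting at `T₂` or after) is kept, together with a family of lower bounds on the
cost. For every `j`, the late jobs cost at least what Smith's rule gives from `T₂`, the early jobs
up to `j` at least what Smith's rule gives from `0`, and every early job `i > j` completes no
earlier than `P_i - k` by the deviation bound. This is `exists_reference_of_feasible`, resting on
`smith_le`. The whole family is needed because the `j` at which idle time is inserted depends on
which quadruples the algorithm happens to keep, not on `τ`.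

The dynamic program is then compared with `L` (`Covered.stage`). Some kept quadruple has `ℓ¹` at
most the early load of `L`, with no error factor, and `ℓ²` and `Z` within a power of `δ` of the
reference. Exactness of `ℓ¹` comes from the rule that the smaller `ℓ¹` survives in a box, and it
guarantees that a job early in `L` still fits before `T₁`. A small `ℓ¹` can only break the lower
deviation bound. In that event case 3 applies, and the full schedule it produces is already good:
`J_{j+1}, …, J_{j₃}` complete at `P_l - k`, which is below every completion time in the reference,
and all jobs after `J_{j₃}` belong to `L`. If this never happens, the surviving quadruple is
completed after `J_{j₃}`.

Each stage costs one factor `δ`, and so does the final box of full schedules. The total is at most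
`δ ^ n`, and `(1 + ε / (2n)) ^ n ≤ exp (ε / 2) ≤ 1 + ε`. Feasibility of the output is an invariant
of the quadruples (`Realizes`, `Partial`, `Full`), independent of the comparison with `L`.

For the running time, every box costs boundedly many steps per stage, and there are at most `n`
stages for each of at most `n` candidates `a`. Since `1 / log δ = O(n / ε)`, the number of boxes is
`O((n / ε) ^ 3)` times three logarithms (`boxes_le`). -/

@[simp] theorem bind_val (x : Timed α) (f : α → Timed β) : (x >>= f).val = (f x.val).val := rfl
@[simp] theorem bind_steps (x : Timed α) (f : α → Timed β) :
    (x >>= f).steps = x.steps + (f x.val).steps := rfl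
@[simp] theorem pure_val (x : α) : (pure x : Timed α).val = x := rfl
@[simp] theorem pure_steps (x : α) : (pure x : Timed α).steps = 0 := rfl

theorem loop_inv {body : ℕ → s → Timed s} (Q : ℕ → s → Prop) (c i : ℕ) (x : s) (h0 : Q i x)
    (hs : ∀ i' x, i ≤ i' → i' < i + c → Q i' x → Q (i' + 1) (body i' x).val) :
    Q (i + c) (loop body c i x).val := by
  induction c generalizing i x with
  | zero => exact h0
  | succ c ih =>
    have h1 := hs i x le_rfl (by omega) h0
    have := ih (i + 1) (body i x).val h1 fun i' y h h' hQ => hs i' y (by omega) (by omega) hQ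
    rw [show i + (c + 1) = i + 1 + c by omega]
    exact this

/-- The final index is a maximum because an empty range leaves the counter at `lo`. -/
theorem forRange_inv {body : ℕ → s → Timed s} {x : s} {lo hi : ℕ} (Q : ℕ → s → Prop)
    (h0 : Q lo x) (hs : ∀ i x, lo ≤ i → i ≤ hi → Q i x → Q (i + 1) (body i x).val) :
    Q (max lo (hi + 1)) (forRange lo hi x body).val := by
  have := loop_inv (body := body) Q (hi + 1 - lo) lo x h0
    fun i y h h' hQ => hs i y h (by omega) hQ
  rwa [show lo + (hi + 1 - lo) = max lo (hi + 1) by omega] at this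

/-- Serves to track the effect of one particular iteration: `R` is created at `i₀` and survives the
later iterations, while `Inv` is available throughout. -/
theorem forRange_reach {body : ℕ → s → Timed s} {x : s} {lo hi i₀ : ℕ} (Inv R : s → Prop)
    (h₁ : lo ≤ i₀) (h₂ : i₀ ≤ hi) (h0 : Inv x)
    (hInv : ∀ i x, lo ≤ i → i ≤ hi → Inv x → Inv (body i x).val)
    (hR : ∀ x, Inv x → R (body i₀ x).val)
    (hkeep : ∀ i x, lo ≤ i → i ≤ hi → Inv x → R x → R (body i x).val) :
    R (forRange lo hi x body).val := by
  refine (forRange_inv (fun i x => Inv x ∧ (i₀ < i → R x)) ⟨h0, by omega⟩ ?_).2 (by omega)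
  rintro i y h h' ⟨hI, hy⟩
  refine ⟨hInv i y h h' hI, fun hi => ?_⟩
  rcases Nat.lt_or_ge i₀ i with hlt | hge
  · exact hkeep i y h h' hI (hy hlt)
  · obtain rfl : i = i₀ := by omega
    exact hR y hI

theorem loop_steps {body : ℕ → s → Timed s} {c k i : ℕ} {x : s}
    (h : ∀ i' x, i ≤ i' → i' < i + k → (body i' x).steps ≤ c) :
    (loop body k i x).steps ≤ k * (c + 1) + 1 := by
  induction k generalizing i x with
  | zero => simp [loop]
  | succ k ih =>
    have h1 := h i x le_rfl (by omega)
    have h2 := ih (i := i + 1) (x := (body i x).val) fun i' y h' h'' => h i' y (by omega) (by omega)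
    have h3 : (loop body (k + 1) i x).steps
        = 1 + ((body i x).steps + (loop body k (i + 1) (body i x).val).steps) := rfl
    rw [h3]
    linarith [add_mul k 1 (c + 1)]

theorem forRange_steps {body : ℕ → s → Timed s} {c lo hi : ℕ} {x : s}
    (h : ∀ i x, lo ≤ i → i ≤ hi → (body i x).steps ≤ c) :
    (forRange lo hi x body).steps ≤ (hi + 1 - lo) * (c + 1) + 1 :=
  loop_steps fun i y h' h'' => h i y h' (by omega)

end Timed

theorem forBoxes_inv {s : Type} {g : Grid} {B : Boxes} {x : s} {body : Quad → s → Timed s}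
    (Inv : s → Prop) (h0 : Inv x)
    (hs : ∀ b q x, B b = some q → Inv x → Inv (body q x).val) :
    Inv (forBoxes g B x body).val := by
  refine forRange_inv (fun _ => Inv) h0 fun i₁ x₁ _ _ h₁ => ?_
  refine forRange_inv (fun _ => Inv) h₁ fun i₂ x₂ _ _ h₂ => ?_
  refine forRange_inv (fun _ => Inv) h₂ fun i₃ x₃ _ _ h₃ => ?_
  simp only [bind_val, readBox]
  cases hb : B (i₁, i₂, i₃) with
  | none => exact h₃
  | some q => exact hs _ q x₃ hb h₃

/-- The boxes that the loops over the boxes visit. -/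
def Grid.InRange (g : Grid) (b : ℕ × ℕ × ℕ) : Prop :=
  b.1 ≤ g.r₁ + 1 ∧ (1 ≤ b.2.1 ∧ b.2.1 ≤ g.r₂ + 1) ∧ 1 ≤ b.2.2 ∧ b.2.2 ≤ g.r₃ + 1

theorem forBoxes_reach {s : Type} {g : Grid} {B : Boxes} {x : s} {body : Quad → s → Timed s}
    {b₀ : ℕ × ℕ × ℕ} {q₀ : Quad} (Inv R : s → Prop) (hb₀ : g.InRange b₀) (hq₀ : B b₀ = some q₀)
    (h0 : Inv x) (hs : ∀ b q x, B b = some q → Inv x → Inv (body q x).val)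
    (hR : ∀ x, Inv x → R (body q₀ x).val)
    (hkeep : ∀ b q x, B b = some q → Inv x → R x → R (body q x).val) :
    R (forBoxes g B x body).val := by
  obtain ⟨b₁, b₂, b₃⟩ := b₀
  obtain ⟨hb₁, ⟨hb₂, hb₂'⟩, hb₃, hb₃'⟩ := hb₀
  have inv3 : ∀ i₁ i₂ i₃ x, Inv x → Inv ((do
      let c ← readBox B (i₁, i₂, i₃)
      match c with
      | none => pure x
      | some q => body q x) : Timed s).val := by
    intro i₁ i₂ i₃ x hx
    simp only [bind_val, readBox]
    cases hb : B (i₁, i₂, i₃) with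
    | none => exact hx
    | some q => exact hs _ q x hb hx
  have keep3 : ∀ i₁ i₂ i₃ x, Inv x → R x → R ((do
      let c ← readBox B (i₁, i₂, i₃)
      match c with
      | none => pure x
      | some q => body q x) : Timed s).val := by
    intro i₁ i₂ i₃ x hx hr
    simp only [bind_val, readBox]
    cases hb : B (i₁, i₂, i₃) with
    | none => exact hr
    | some q => exact hkeep _ q x hb hx hr
  have inv2 : ∀ i₁ i₂ x, Inv x → Inv (forRange 1 (g.r₃ + 1) x fun i₃ x₃ => (do
      let c ← readBox B (i₁, i₂, i₃)
      match c with
      | none => pure x₃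
      | some q => body q x₃)).val := fun i₁ i₂ x hx =>
    forRange_inv (fun _ => Inv) hx fun i₃ y _ _ hy => inv3 i₁ i₂ i₃ y hy
  have keep2 : ∀ i₁ i₂ x, Inv x → R x → R (forRange 1 (g.r₃ + 1) x fun i₃ x₃ => (do
      let c ← readBox B (i₁, i₂, i₃)
      match c with
      | none => pure x₃
      | some q => body q x₃)).val := fun i₁ i₂ x hx hr =>
    (forRange_inv (fun _ y => Inv y ∧ R y) ⟨hx, hr⟩ fun i₃ y _ _ hy =>
      ⟨inv3 i₁ i₂ i₃ y hy.1, keep3 i₁ i₂ i₃ y hy.1 hy.2⟩).2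
  refine forRange_reach (i₀ := b₁) Inv R (Nat.zero_le _) hb₁ h0 ?_ ?_ ?_
  · intro i₁ x₁ _ _ h₁
    exact forRange_inv (fun _ => Inv) h₁ fun i₂ y _ _ hy => inv2 i₁ i₂ y hy
  · intro x₁ h₁
    refine forRange_reach (i₀ := b₂) Inv R hb₂ hb₂' h₁ (fun i₂ y _ _ hy => inv2 b₁ i₂ y hy) ?_
      (fun i₂ y _ _ hy hr => keep2 b₁ i₂ y hy hr)
    intro x₂ h₂
    refine forRange_reach (i₀ := b₃) Inv R hb₃ hb₃' h₂ (fun i₃ y _ _ hy => inv3 b₁ b₂ i₃ y hy) ?_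
      (fun i₃ y _ _ hy hr => keep3 b₁ b₂ i₃ y hy hr)
    intro x₃ h₃
    simp only [bind_val, readBox, hq₀]
    exact hR x₃ h₃
  · intro i₁ x₁ _ _ h₁ hr
    exact (forRange_inv (fun _ y => Inv y ∧ R y) ⟨h₁, hr⟩ fun i₂ y _ _ hy =>
      ⟨inv2 i₁ i₂ y hy.1, keep2 i₁ i₂ y hy.1 hy.2⟩).2

theorem forBoxes_steps {s : Type} {g : Grid} {B : Boxes} {x : s} {body : Quad → s → Timed s}
    {c : ℕ} (h : ∀ q x, (body q x).steps ≤ c) :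
    (forBoxes g B x body).steps ≤ (c + 10) * ((g.r₁ + 2) * (g.r₂ + 1) * (g.r₃ + 1)) := by
  have h3 : ∀ i₁ i₂ i₃ x, ((do
      let c ← readBox B (i₁, i₂, i₃)
      match c with
      | none => pure x
      | some q => body q x) : Timed s).steps ≤ c + 1 := by
    intro i₁ i₂ i₃ x
    simp only [bind_steps, readBox]
    cases hb : B (i₁, i₂, i₃) with
    | none => simp
    | some q => have := h q x; simp only; omega
  have h1 : (forBoxes g B x body).steps ≤ 3 + ((g.r₁ + 1 + 1 - 0) *
      ((g.r₂ + 1 + 1 - 1) * ((g.r₃ + 1 + 1 - 1) * (c + 1 + 1) + 1 + 1) + 1 + 1) + 1) := by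
    have := forRange_steps (lo := 0) (hi := g.r₁ + 1) (x := x) (body := fun i₁ x₁ =>
      forRange 1 (g.r₂ + 1) x₁ fun i₂ x₂ => forRange 1 (g.r₃ + 1) x₂ fun i₃ x₃ => (do
        let c ← readBox B (i₁, i₂, i₃)
        match c with
        | none => pure x₃
        | some q => body q x₃)) fun i₁ x₁ _ _ => forRange_steps fun i₂ x₂ _ _ =>
          forRange_steps fun i₃ x₃ _ _ => h3 i₁ i₂ i₃ x₃
    have e : (forBoxes g B x body).steps = 1 + (1 + (1 + (forRange 0 (g.r₁ + 1) x (fun i₁ x₁ =>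
      forRange 1 (g.r₂ + 1) x₁ fun i₂ x₂ => forRange 1 (g.r₃ + 1) x₂ fun i₃ x₃ => (do
        let c ← readBox B (i₁, i₂, i₃)
        match c with
        | none => pure x₃
        | some q => body q x₃))).steps)) := rfl
    omega
  refine h1.trans ?_
  simp only [Nat.add_sub_cancel, Nat.sub_zero]
  generalize g.r₁ = u
  generalize g.r₂ = v
  generalize g.r₃ = w
  nlinarith [Nat.zero_le (u * v), Nat.zero_le (v * w), Nat.zero_le (u * w),
    Nat.zero_le (u * v * w), Nat.zero_le (u*v*w*c)]

/-! ### Sequencing on a single machine -/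

/-- Disjoint jobs that start at `t` or later and end by `T` fit into `[t, T]`. -/
theorem sum_le_of_disjoint {σ : ℕ → ℝ} {p : ℕ → ℕ} {t T : ℝ} (A : Finset ℕ) (hT : t ≤ T)
    (hp : ∀ i ∈ A, 0 < p i)
    (hd : ∀ i ∈ A, ∀ j ∈ A, i ≠ j → σ i + p i ≤ σ j ∨ σ j + p j ≤ σ i)
    (ht : ∀ i ∈ A, t ≤ σ i) (hC : ∀ i ∈ A, σ i + p i ≤ T) :
    t + ∑ i ∈ A, (p i : ℝ) ≤ T := by
  induction A using Finset.strongInduction generalizing T with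
  | H A ih =>
    rcases A.eq_empty_or_nonempty with rfl | hA
    · simpa using hT
    obtain ⟨m, hm, hmax⟩ := A.exists_max_image (fun i => σ i + p i) hA
    -- Remove the job that completes last: all others must be finished by its start, so the deadline
    -- shrinks from `T` to `σ m`.
    have h := ih (A.erase m) (erase_ssubset hm) (T := σ m) (ht m hm)
      (fun i hi => hp i (mem_of_mem_erase hi))
      (fun i hi j hj => hd i (mem_of_mem_erase hi) j (mem_of_mem_erase hj))
      (fun i hi => ht i (mem_of_mem_erase hi)) (fun i hi => by
        have hi' := mem_of_mem_erase hi
        rcases hd i hi' m hm (ne_of_mem_erase hi) with h | h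
        · exact h
        · have h1 := hmax i hi'
          have h2 : (0 : ℝ) < p i := by exact_mod_cast hp i hi'
          linarith)
    rw [← add_sum_erase A _ hm]
    linarith [hC m hm]

/-- Smith's rule: sequencing in the order of the ratios `p / w` without idle time is optimal. -/
theorem smith_le {σ : ℕ → ℝ} {p w : ℕ → ℕ} {t : ℝ} (A : Finset ℕ)
    (hp : ∀ i ∈ A, 0 < p i)
    (hr : ∀ i ∈ A, ∀ j ∈ A, i ≤ j → p i * w j ≤ p j * w i)
    (hd : ∀ i ∈ A, ∀ j ∈ A, i ≠ j → σ i + p i ≤ σ j ∨ σ j + p j ≤ σ i)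
    (ht : ∀ i ∈ A, t ≤ σ i) :
    ∑ i ∈ A, (w i : ℝ) * (t + ∑ l ∈ A with l ≤ i, (p l : ℝ)) ≤
      ∑ i ∈ A, (w i : ℝ) * (σ i + p i) := by
  induction A using Finset.strongInduction with
  | H A ih =>
    rcases A.eq_empty_or_nonempty with rfl | hA
    · simp
    obtain ⟨m, hm, hmax⟩ := A.exists_max_image (fun i => σ i + p i) hA
    have h := ih (A.erase m) (erase_ssubset hm)
      (fun i hi => hp i (mem_of_mem_erase hi))
      (fun i hi j hj => hr i (mem_of_mem_erase hi) j (mem_of_mem_erase hj))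
      (fun i hi j hj => hd i (mem_of_mem_erase hi) j (mem_of_mem_erase hj))
      (fun i hi => ht i (mem_of_mem_erase hi))
    have hC : t + ∑ i ∈ A, (p i : ℝ) ≤ σ m + p m :=
      sum_le_of_disjoint A (by linarith [ht m hm, (p m).cast_nonneg (α := ℝ)]) hp hd ht hmax
    -- Remove the job `m` that completes last and reinsert it at its place by index. A job `i > m`
    -- is then delayed by `p m`, at cost `w i * p m ≤ w m * p i`. Summed over `i > m`, this is what
    -- `m` saves by not waiting for those jobs.
    have hsplit : ∀ i ∈ A.erase m, (w i : ℝ) * (t + ∑ l ∈ A with l ≤ i, (p l : ℝ)) ≤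
        (w i : ℝ) * (t + ∑ l ∈ A.erase m with l ≤ i, (p l : ℝ)) +
          (if m < i then (w m : ℝ) * p i else 0) := by
      intro i hi
      have hi' := mem_of_mem_erase hi
      rw [sum_filter, ← add_sum_erase A _ hm, ← sum_filter]
      have hne := ne_of_mem_erase hi
      rcases lt_or_gt_of_ne hne with hlt | hgt
      · simp [not_le.2 hlt, not_lt.2 hlt.le]
      · have := hr m hm i hi' hgt.le
        have : (p m : ℝ) * w i ≤ p i * w m := by exact_mod_cast this
        simp only [hgt.le, hgt, if_true]
        linarith
    have hsum := sum_le_sum hsplit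
    rw [sum_add_distrib, ← sum_filter, ← mul_sum] at hsum
    have hmid : ∑ l ∈ A with l ≤ m, (p l : ℝ) + ∑ l ∈ A.erase m with m < l, (p l : ℝ) =
        ∑ l ∈ A, (p l : ℝ) := by
      rw [← sum_filter_add_sum_filter_not A (fun l => l ≤ m)]
      congr 1
      refine sum_congr ?_ fun _ _ => rfl
      ext l
      simp only [mem_filter, mem_erase, not_le]
      constructor
      · rintro ⟨⟨_, h⟩, h'⟩; exact ⟨h, h'⟩
      · rintro ⟨h, h'⟩; exact ⟨⟨h'.ne', h⟩, h'⟩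
    have hw := mul_le_mul_of_nonneg_left hC (w m).cast_nonneg
    rw [← hmid] at hw
    rw [← add_sum_erase A _ hm, ← add_sum_erase A (fun i => (w i : ℝ) * (σ i + p i)) hm]
    nlinarith

/-! ### Prefix sums -/

namespace Problem

variable (I : Problem)

/-- `P_j`. -/
def pre (j : ℕ) : ℕ := ∑ i ∈ Icc 1 j, I.p i

/-- `w_1 + … + w_j`. -/
def preW (j : ℕ) : ℕ := ∑ i ∈ Icc 1 j, I.w i

/-- `w_1 P_1 + … + w_j P_j`. -/
def preZ (j : ℕ) : ℕ := ∑ i ∈ Icc 1 j, I.w i * I.pre i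

@[simp] theorem pre_zero : I.pre 0 = 0 := by simp [pre]
@[simp] theorem preW_zero : I.preW 0 = 0 := by simp [preW]
@[simp] theorem preZ_zero : I.preZ 0 = 0 := by simp [preZ]

theorem pre_succ (j : ℕ) : I.pre (j + 1) = I.pre j + I.p (j + 1) :=
  sum_Icc_succ_top (by omega) _

theorem preW_succ (j : ℕ) : I.preW (j + 1) = I.preW j + I.w (j + 1) :=
  sum_Icc_succ_top (by omega) _

theorem preZ_succ (j : ℕ) : I.preZ (j + 1) = I.preZ j + I.w (j + 1) * I.pre (j + 1) :=
  sum_Icc_succ_top (by omega) _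

theorem pre_mono : Monotone I.pre := monotone_nat_of_le_succ fun j => by rw [pre_succ]; omega
theorem preW_mono : Monotone I.preW := monotone_nat_of_le_succ fun j => by rw [preW_succ]; omega
theorem preZ_mono : Monotone I.preZ := monotone_nat_of_le_succ fun j => by rw [preZ_succ]; omega

theorem pre_sub_one {j : ℕ} (h : 1 ≤ j) : I.pre j = I.pre (j - 1) + I.p j := by
  obtain ⟨j, rfl⟩ := Nat.exists_eq_add_of_le' h
  exact I.pre_succ j

theorem planStart_eq (j : ℕ) : I.planStart j = I.pre (j - 1) := by
  unfold planStart pre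
  congr 1

theorem planCompl_eq {j : ℕ} (h : 1 ≤ j) : I.planCompl j = I.pre j := by
  rw [planCompl, planStart_eq, I.pre_sub_one h]

theorem totalP_eq : I.totalP = I.pre I.n := rfl
theorem totalW_eq : I.totalW = I.preW I.n := rfl

/-- The total weighted completion time of `J_{i+1}, …, J_j` processed consecutively from time `t`. -/
def seg (i j t : ℕ) : ℕ := ∑ m ∈ Ioc i j, I.w m * (t + (I.pre m - I.pre i))

theorem seg_succ (i t : ℕ) : I.seg i (i + 1) t = I.w (i + 1) * (t + I.p (i + 1)) := by
  have : Ioc i (i + 1) = {i + 1} := by ext; simp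
  simp [seg, this, pre_succ]

theorem sum_Icc_add_sum_Ioc {M : Type*} [AddCommMonoid M] (f : ℕ → M) {i j : ℕ} (h : i ≤ j) :
    ∑ m ∈ Icc 1 i, f m + ∑ m ∈ Ioc i j, f m = ∑ m ∈ Icc 1 j, f m := by
  rw [← sum_union]
  · congr 1
    ext m
    simp only [mem_union, mem_Icc, mem_Ioc]
    omega
  · rw [disjoint_left]
    intro m
    simp only [mem_Icc, mem_Ioc]
    omega

/-- The prefix-sum formula uses truncated subtraction; monotonicity of the prefix sums makes every
difference genuine. -/
theorem seg_eq {i j : ℕ} (h : i ≤ j) (t : ℕ) :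
    I.preZ j - I.preZ i - I.pre i * (I.preW j - I.preW i) + (I.preW j - I.preW i) * t =
      I.seg i j t := by
  have hW : I.preW j - I.preW i = ∑ m ∈ Ioc i j, I.w m := by
    have := sum_Icc_add_sum_Ioc I.w h
    simp only [preW]; omega
  have hZ : I.preZ j - I.preZ i = ∑ m ∈ Ioc i j, I.w m * I.pre m := by
    have := sum_Icc_add_sum_Ioc (fun m => I.w m * I.pre m) h
    simp only [preZ]; omega
  rw [hW, hZ, mul_sum, sum_mul]
  have key : ∑ m ∈ Ioc i j, I.w m * I.pre m =
      ∑ m ∈ Ioc i j, I.w m * (I.pre m - I.pre i) + ∑ m ∈ Ioc i j, I.pre i * I.w m := by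
    rw [← sum_add_distrib]
    refine sum_congr rfl fun m hm => ?_
    have := I.pre_mono (mem_Ioc.1 hm).1.le
    rw [mul_comm (I.pre i), ← mul_add]
    congr 1
    omega
  rw [key, Nat.add_sub_cancel, ← sum_add_distrib, seg]
  exact sum_congr rfl fun m _ => by ring

end Problem

/-! ### Schedules described by blocks -/

/-- `bl` describes the starting times `s` of `J_1, …, J_m`. -/
structure Describes (I : Problem) (bl : List (ℕ × ℕ)) (m : ℕ) (s : ℕ → ℕ) : Prop where
  last : (lastJob bl).val = m
  eq : ∀ A i, 1 ≤ i → i ≤ m → (backtrack I bl A).val i = s i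
  off : ∀ A i, m < i → (backtrack I bl A).val i = A i

theorem describes_nil (I : Problem) (s : ℕ → ℕ) : Describes I [] 0 s :=
  ⟨rfl, fun _ _ _ _ => by omega, fun _ _ _ => rfl⟩

/-- Backtracking writes the newest block first and then handles the older ones. The older ones never
touch indices above `m`, so the new block survives. This is why `Describes` quantifies over the
initial array and records the untouched range. -/
theorem Describes.cons {I : Problem} {bl : List (ℕ × ℕ)} {m m' t : ℕ} {s : ℕ → ℕ}
    (h : Describes I bl m s) (hm : m ≤ m') :
    Describes I ((m', t) :: bl) m' fun i => if i ≤ m then s i else t + (I.pre (i - 1) - I.pre m) := by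
  have key : ∀ A : ℕ → ℕ, ∃ A' : ℕ → ℕ, (backtrack I ((m', t) :: bl) A).val = (backtrack I bl A').val ∧
      ∀ x, A' x = if m < x ∧ x ≤ m' then t + (I.pre (x - 1) - I.pre m) else A x := by
    intro A
    refine ⟨_, rfl, ?_⟩
    have hlast := h.last
    rw [hlast]
    have := (forRange_inv (lo := m + 1) (hi := m') (x := (A, t)) (body := fun i At => (do
      let A' ← writeA At.1 i At.2
      let pi ← readA I.p i
      let t' ← addN At.2 pi
      pure (A', t') : Timed ((ℕ → ℕ) × ℕ)))
      (fun i At => At.2 = t + (I.pre (i - 1) - I.pre m) ∧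
        ∀ x, At.1 x = if m < x ∧ x < i then t + (I.pre (x - 1) - I.pre m) else A x) ?_ ?_).2
    · rw [show max (m + 1) (m' + 1) = m' + 1 by omega] at this
      simp only [Nat.lt_succ_iff] at this
      exact this
    · refine ⟨by simp, fun x => ?_⟩
      rw [if_neg (by omega)]
    · rintro i ⟨A₁, t₁⟩ hi hi' ⟨h₁, h₂⟩
      simp only at h₁ h₂
      refine ⟨?_, fun x => ?_⟩
      · simp only [bind_val, pure_val, writeA, readA, addN, h₁, Nat.add_sub_cancel]
        have := I.pre_sub_one (j := i) (by omega)
        have := I.pre_mono (show m ≤ i - 1 by omega)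
        omega
      · simp only [bind_val, pure_val, writeA, readA, addN]
        by_cases hx : x = i
        · subst hx
          rw [Function.update_self, if_pos ⟨by omega, by omega⟩, h₁]
        · rw [Function.update_of_ne hx, h₂]
          by_cases hc : m < x ∧ x < i
          · rw [if_pos hc, if_pos ⟨hc.1, by omega⟩]
          · rw [if_neg hc, if_neg (by omega)]
  refine ⟨rfl, fun A i h1 h2 => ?_, fun A i hi => ?_⟩
  · obtain ⟨A', e, hA'⟩ := key A
    rw [e]
    by_cases hi : i ≤ m
    · rw [h.eq A' i h1 hi, if_pos hi]
    · rw [h.off A' i (by omega), hA', if_pos ⟨by omega, h2⟩, if_neg hi]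
  · obtain ⟨A', e, hA'⟩ := key A
    rw [e, h.off A' i (by omega), hA', if_neg (by omega)]

/-- The blocks `bl` describe a schedule of `J_1, …, J_m` that keeps to the deviation bound and the
availability of the machine, with completion times at most `l1` or in `[T₂, l2]`, and with total
weighted completion time `Z`. -/
def Realizes (I : Problem) (bl : List (ℕ × ℕ)) (m l1 l2 Z : ℕ) : Prop :=
  (l1 ≤ I.T₁ ∧ I.T₂ ≤ l2 ∧ l2 ≤ I.pre m + I.T₂) ∧ (∀ b ∈ bl, b.1 ≤ m) ∧ ∃ s : ℕ → ℕ, Describes I bl m s ∧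
    (∀ i, 1 ≤ i → i ≤ m → (s i + I.p i ≤ l1 ∨ (I.T₂ ≤ s i ∧ s i + I.p i ≤ l2)) ∧
      s i ≤ I.pre (i - 1) + I.k ∧ I.pre (i - 1) ≤ s i + I.k ∧ s i ≤ I.pre (i - 1) + I.T₂ ∧
      ∀ j, i < j → j ≤ m → s i + I.p i ≤ s j ∨ s j + I.p j ≤ s i) ∧
    Z = ∑ i ∈ Icc 1 m, I.w i * (s i + I.p i)

theorem realizes_nil (I : Problem) : Realizes I [] 0 0 I.T₂ 0 :=
  ⟨by simp, by simp, fun _ => 0, describes_nil I _, fun i _ _ => by omega, by simp⟩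

/-- The new block sits after everything in its own half, the early or the late one, and `T₁ < T₂`
separates the halves, so no overlap arises. All jobs of a block are shifted against `π*` by the same
amount, so the deviation needs checking only at the start of the block. -/
theorem Realizes.append {I : Problem} {bl : List (ℕ × ℕ)} {m m' t l1 l2 l1' l2' Z : ℕ}
    (h : Realizes I bl m l1 l2 Z) (hm : m ≤ m') (h1 : l1 ≤ l1') (h2 : l2 ≤ l2')
    (hT : l1' ≤ I.T₁) (hT' : l2' ≤ I.pre m' + I.T₂)
    (hlt : I.T₁ < I.T₂)
    (hb : l1 ≤ t ∧ t + I.pre m' ≤ l1' + I.pre m ∨ l2 ≤ t ∧ t + I.pre m' ≤ l2' + I.pre m)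
    (hk : t ≤ I.pre m + I.k) (hk' : I.pre m ≤ t + I.k) (ht : t ≤ I.pre m + I.T₂) :
    Realizes I ((m', t) :: bl) m' l1' l2' (Z + I.seg m m' t) := by
  obtain ⟨⟨a1, a2, a3⟩, hbl, s, hs, hf, hZ⟩ := h
  refine ⟨⟨hT, by omega, hT'⟩, ?_, _, hs.cons hm, ?_, ?_⟩
  · intro b hb
    rcases List.mem_cons.1 hb with rfl | hb
    · exact le_rfl
    · exact (hbl b hb).trans hm
  · intro i hi hi'
    have hpi := I.pre_sub_one hi
    by_cases him : i ≤ m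
    · obtain ⟨c1, c2, c3, c4, c5⟩ := hf i hi him
      simp only [if_pos him]
      refine ⟨by omega, c2, c3, c4, fun j hij hj => ?_⟩
      by_cases hjm : j ≤ m
      · simp only [if_pos hjm]
        exact c5 j hij hjm
      · simp only [if_neg hjm]
        have := I.pre_sub_one (j := j) (by omega)
        have := I.pre_mono (show m ≤ j - 1 by omega)
        have := I.pre_mono (show j ≤ m' by omega)
        omega
    · simp only [if_neg him]
      have := I.pre_mono (show m ≤ i - 1 by omega)
      have := I.pre_mono (show i ≤ m' by omega)
      refine ⟨by omega, by omega, by omega, by omega, fun j hij hj => ?_⟩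
      rw [if_neg (by omega)]
      have := I.pre_mono (show i ≤ j - 1 by omega)
      omega
  · rw [← Problem.sum_Icc_add_sum_Ioc _ hm, hZ, Problem.seg]
    congr 1
    · refine sum_congr rfl fun i hi => ?_
      rw [if_pos (mem_Icc.1 hi).2]
    · refine sum_congr rfl fun i hi => ?_
      have hi := mem_Ioc.1 hi
      rw [if_neg (by omega)]
      have := I.pre_sub_one (j := i) (by omega)
      have := I.pre_mono (show m ≤ i - 1 by omega)
      congr 1
      omega

/-- No job starts more than `T₂` after its start in `π*`; this keeps `Z` inside the grid. -/
theorem Realizes.le_upper {I : Problem} {bl : List (ℕ × ℕ)} {m l1 l2 Z : ℕ}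
    (h : Realizes I bl m l1 l2 Z) : Z ≤ I.preZ m + I.preW m * I.T₂ := by
  obtain ⟨-, -, s, -, hf, rfl⟩ := h
  rw [Problem.preZ, Problem.preW, sum_mul, ← sum_add_distrib]
  refine sum_le_sum fun i hi => ?_
  have hi := mem_Icc.1 hi
  rw [← mul_add]
  refine Nat.mul_le_mul_left _ ?_
  have := (hf i hi.1 hi.2).2.2.2.1
  have := I.pre_sub_one hi.1
  omega

theorem Realizes.feasible {I : Problem} {bl : List (ℕ × ℕ)} {l1 l2 Z : ℕ}
    (h : Realizes I bl I.n l1 l2 Z) (A : ℕ → ℕ) :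
    I.Feasible (fun j => ((backtrack I bl A).val j : ℝ)) ∧
      I.objective (fun j => ((backtrack I bl A).val j : ℝ)) = Z := by
  obtain ⟨⟨hT, -, -⟩, -, s, hs, hf, rfl⟩ := h
  have e : ∀ i ∈ I.jobs, (backtrack I bl A).val i = s i := fun i hi =>
    hs.eq A i (mem_Icc.1 hi).1 (mem_Icc.1 hi).2
  refine ⟨⟨fun j _ => by positivity, fun i hi j hj hij => ?_, fun j hj => ?_, fun j hj => ?_⟩, ?_⟩
  · simp only [e i hi, e j hj]
    have hi := mem_Icc.1 hi
    have hj := mem_Icc.1 hj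
    norm_cast
    rcases lt_or_gt_of_ne hij with h | h
    · exact (hf i hi.1 hi.2).2.2.2.2 j h hj.2
    · exact ((hf j hj.1 hj.2).2.2.2.2 i h hi.2).symm
  · simp only [e j hj]
    have hj := mem_Icc.1 hj
    norm_cast
    have := (hf j hj.1 hj.2).1
    omega
  · simp only [e j hj]
    have hj := mem_Icc.1 hj
    obtain ⟨-, c1, c2, -⟩ := hf j hj.1 hj.2
    have hp := I.pre_sub_one hj.1
    rw [I.planCompl_eq hj.1, abs_le]
    have h1 : (s j : ℝ) ≤ I.pre (j - 1) + I.k := by exact_mod_cast c1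
    have h2 : (I.pre (j - 1) : ℝ) ≤ s j + I.k := by exact_mod_cast c2
    have h3 : (I.pre j : ℝ) = I.pre (j - 1) + I.p j := by exact_mod_cast hp
    constructor <;> linarith
  · rw [Problem.objective]
    push_cast
    exact sum_congr rfl fun i hi => by rw [e i hi]

/-- Each block is charged for `N` jobs regardless of its length. The resulting quadratic bound is
negligible against the dynamic program. -/
theorem backtrack_steps {I : Problem} {N : ℕ} (bl : List (ℕ × ℕ)) (h : ∀ b ∈ bl, b.1 ≤ N) (A : ℕ → ℕ) :
    (backtrack I bl A).steps ≤ bl.length * (4 * N + 3) + 1 := by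
  induction bl generalizing A with
  | nil => simp [backtrack]
  | cons b rest ih =>
    have hb := h b (by simp)
    have e : (backtrack I (b :: rest) A).steps = (lastJob rest).steps + (1 +
        ((forRange ((lastJob rest).val + 1) b.1 (A, b.2) fun i At => (do
          let A' ← writeA At.1 i At.2
          let pi ← readA I.p i
          let t' ← addN At.2 pi
          pure (A', t') : Timed ((ℕ → ℕ) × ℕ))).steps +
        (backtrack I rest (forRange ((lastJob rest).val + 1) b.1 (A, b.2) fun i At => (do
          let A' ← writeA At.1 i At.2
          let pi ← readA I.p i
          let t' ← addN At.2 pi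
          pure (A', t') : Timed ((ℕ → ℕ) × ℕ))).val.1).steps)) := rfl
    have h1 : (lastJob rest).steps = 1 := by cases rest <;> rfl
    have h2 := forRange_steps (lo := (lastJob rest).val + 1) (hi := b.1) (x := (A, b.2)) (c := 3)
      (body := fun i At => (do
          let A' ← writeA At.1 i At.2
          let pi ← readA I.p i
          let t' ← addN At.2 pi
          pure (A', t') : Timed ((ℕ → ℕ) × ℕ))) (fun i x _ _ => le_rfl)
    have h3 := ih (fun b hb => h b (by simp [hb])) (forRange ((lastJob rest).val + 1) b.1 (A, b.2)
      fun i At => (do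
          let A' ← writeA At.1 i At.2
          let pi ← readA I.p i
          let t' ← addN At.2 pi
          pure (A', t') : Timed ((ℕ → ℕ) × ℕ))).val.1
    rw [e, h1, List.length_cons, add_mul]
    omega

/-! ### Preprocessing -/

/-- The specification of `preprocess`. -/
structure Prep.Correct (I : Problem) (d : Prep) : Prop where
  P : ∀ j ≤ I.n, d.P j = I.pre j
  W : ∀ j ≤ I.n, d.W j = I.preW j
  Z : ∀ j ≤ I.n, d.Z j = I.preZ j
  pmin_pos : 1 ≤ d.pmin
  j₁_le : d.j₁ ≤ I.n
  le_j₁_iff : ∀ a, 1 ≤ a → a ≤ I.n → (a ≤ d.j₁ ↔ I.pre (a - 1) ≤ I.T₁)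
  j₃_le : d.j₃ ≤ I.n
  pre_j₃_le : I.pre d.j₃ ≤ I.T₁ + I.k
  le_j₃ : ∀ i ≤ I.n, I.pre i ≤ I.T₁ + I.k → i ≤ d.j₃

theorem Problem.Valid.n_pos {I : Problem} (h : I.Valid) : 1 ≤ I.n := by
  by_contra hn
  have := h.T₁_lt_P
  rw [I.totalP_eq, show I.n = 0 by omega] at this
  simp at this

/-- What the loop of `preprocess` has established before the iteration `i`. -/
structure Prep.CorrectBelow (I : Problem) (i : ℕ) (d : Prep) : Prop where
  P : ∀ j < i, d.P j = I.pre j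
  W : ∀ j < i, d.W j = I.preW j
  Z : ∀ j < i, d.Z j = I.preZ j
  pmin_pos : 1 ≤ d.pmin
  j₁ : (d.j₁ = 0 ∧ ∀ j < i, I.pre j ≤ I.T₁) ∨
    (1 ≤ d.j₁ ∧ d.j₁ < i ∧ I.T₁ < I.pre d.j₁ ∧ I.pre (d.j₁ - 1) ≤ I.T₁)
  j₃_lt : d.j₃ < i
  pre_j₃_le : I.pre d.j₃ ≤ I.T₁ + I.k
  le_j₃ : ∀ j < i, I.pre j ≤ I.T₁ + I.k → j ≤ d.j₃

theorem update_eq_of_lt {A f : ℕ → ℕ} {i x : ℕ} (hA : ∀ j < i, A j = f j) (hx : x = f i) :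
    ∀ j < i + 1, Function.update A i x j = f j := by
  intro j hj
  by_cases h : j = i
  · subst h; simp [hx]
  · rw [Function.update_of_ne h, hA j (by omega)]

theorem preprocess_correct {I : Problem} (h : I.Valid) : Prep.Correct I (preprocess I).val := by
  have hn := h.n_pos
  suffices hb : Prep.CorrectBelow I (max 1 (I.n + 1)) (preprocess I).val by
    rw [show max 1 (I.n + 1) = I.n + 1 by omega] at hb
    generalize (preprocess I).val = d at hb
    have hT : I.T₁ < I.pre I.n := h.T₁_lt_P
    refine ⟨fun j hj => hb.P j (by omega), fun j hj => hb.W j (by omega),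
      fun j hj => hb.Z j (by omega), hb.pmin_pos, ?_, fun a ha ha' => ?_, ?_, hb.pre_j₃_le,
      fun i hi => hb.le_j₃ i (by omega)⟩
    · rcases hb.j₁ with h1 | h1 <;> omega
    · rcases hb.j₁ with ⟨-, h1⟩ | ⟨h1, h2, h3, h4⟩
      · have := h1 I.n (by omega)
        omega
      · refine ⟨fun hle => (I.pre_mono (by omega)).trans h4, fun hle => ?_⟩
        by_contra hlt
        have := I.pre_mono (show d.j₁ ≤ a - 1 by omega)
        omega
    · have := hb.j₃_lt
      omega
  refine forRange_inv (fun i d => Prep.CorrectBelow I i d) ?_ ?_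
  · have hp := h.p_pos 1 (by simp [Problem.jobs, hn])
    constructor <;> simp [newArr, readA]; omega
  · rintro i d hi hi' hd
    have e : i - 1 < i := by omega
    have eP := hd.P _ e
    have eW := hd.W _ e
    have eZ := hd.Z _ e
    have sP := I.pre_succ (i - 1)
    have sW := I.preW_succ (i - 1)
    have sZ := I.preZ_succ (i - 1)
    rw [Nat.sub_add_cancel hi] at sP sW sZ
    have hp := h.p_pos i (by simp [Problem.jobs]; omega)
    simp only [bind_val, pure_val, readA, writeA, addN, subN, mulN, minN, eqN, ltN, leN, eP, eW, eZ,
      ← sP, ← sW, ← sZ]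
    refine ⟨update_eq_of_lt hd.P rfl, update_eq_of_lt hd.W rfl, update_eq_of_lt hd.Z rfl,
      le_min hd.pmin_pos hp, ?_, ?_, ?_, ?_⟩
    · simp only [Bool.and_eq_true, decide_eq_true_eq]
      rcases hd.j₁ with ⟨h1, h2⟩ | ⟨h1, h2, h3⟩
      · by_cases hl : I.T₁ < I.pre i
        · right
          rw [if_pos ⟨h1, hl⟩]
          exact ⟨hi, by omega, hl, h2 _ e⟩
        · left
          rw [if_neg (by omega)]
          refine ⟨h1, fun j hj => ?_⟩
          rcases Nat.lt_succ_iff_lt_or_eq.1 hj with hj | rfl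
          · exact h2 j hj
          · omega
      · right
        rw [if_neg (by omega)]
        exact ⟨h1, by omega, h3⟩
    · have := hd.j₃_lt
      dsimp only
      split_ifs <;> omega
    · have := hd.pre_j₃_le
      dsimp only
      split_ifs with hc
      · exact of_decide_eq_true hc
      · assumption
    · intro j hj hle
      have := hd.j₃_lt
      dsimp only
      rcases Nat.lt_succ_iff_lt_or_eq.1 hj with hj | rfl
      · have := hd.le_j₃ j hj hle
        split_ifs <;> omega
      · exact (if_pos (decide_eq_true hle)).ge

theorem preprocess_steps (I : Problem) : (preprocess I).steps ≤ 32 * I.n + 20 := by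
  have h1 := fun x => forRange_steps (lo := 1) (hi := I.n) (x := x) (c := 25) (body := fun i d => (do
    let pi ← readA I.p i
    let wi ← readA I.w i
    let i' ← subN i 1
    let P' ← readA d.P i'
    let Pi ← addN P' pi
    let PA ← writeA d.P i Pi
    let W' ← readA d.W i'
    let Wi ← addN W' wi
    let WA ← writeA d.W i Wi
    let Z' ← readA d.Z i'
    let wP ← mulN wi Pi
    let Zi ← addN Z' wP
    let ZA ← writeA d.Z i Zi
    let m ← minN d.pmin pi
    let unset ← eqN d.j₁ 0
    let late ← ltN I.T₁ Pi
    let early ← leN Pi (I.T₁ + I.k)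
    pure ⟨PA, WA, ZA, m, if unset && late then i else d.j₁, if early then i else d.j₃⟩ : Timed Prep))
    (fun i x _ _ => by simp [readA, subN, addN, writeA, mulN, minN, eqN, ltN, leN])
  have h2 := h1 ⟨fun _ => 0, fun _ => 0, fun _ => 0, I.p 1, 0, 0⟩
  have e : (preprocess I).steps = 1 + ((I.n + 1) + ((I.n + 1) + ((I.n + 1) + (1 + (1 + _))))) := rfl
  rw [e]
  refine le_trans (Nat.add_le_add_left (Nat.add_le_add_left (Nat.add_le_add_left
    (Nat.add_le_add_left (Nat.add_le_add_left (Nat.add_le_add_left h2 _) _) _) _) _) _) ?_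
  omega

theorem segment_val {I : Problem} {d : Prep} (hd : d.Correct I) {i j : ℕ} (hij : i ≤ j) (hj : j ≤ I.n)
    (t : ℕ) : (segment d i j t).val = I.seg i j t := by
  have hi := hij.trans hj
  simp only [segment, bind_val, readA, addN, subN, mulN, hd.Z _ hi, hd.Z _ hj, hd.W _ hi, hd.W _ hj,
    hd.P _ hi, I.seg_eq hij]

/-! ### Boxes -/

theorem boxIndex_val (l : ℝ) (L x : ℕ) :
    (boxIndex l L x).val = if x = 0 then 0 else max 1 ⌈Real.log (x / L) / l⌉₊ := by
  by_cases hx : x = 0 <;> simp [boxIndex, eqN, toR, divR, logR, ceilR, maxN, hx]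

theorem logRatio_val (l : ℝ) (L U : ℕ) :
    (logRatio l L U).val = ⌊Real.log (U / L) / l⌋₊ := rfl

/-- No lower bound on `x` is required: a negative logarithm has natural ceiling `0`. -/
theorem boxIndex_le {l : ℝ} {L U x : ℕ} (hl : 0 < l) (hL : 0 < L) (hx : x ≤ U) :
    (boxIndex l L x).val ≤ (logRatio l L U).val + 1 := by
  rw [boxIndex_val, logRatio_val]
  split_ifs with h0
  · omega
  refine max_le (by omega) (Nat.ceil_le.2 ?_)
  have h1 : Real.log (x / L) / l ≤ Real.log (U / L) / l := by
    have hx0 : (0 : ℝ) < x := by exact_mod_cast Nat.pos_of_ne_zero h0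
    have hL0 : (0 : ℝ) < L := by exact_mod_cast hL
    have hxU : (x : ℝ) ≤ U := by exact_mod_cast hx
    gcongr
  push_cast
  exact h1.trans (Nat.lt_floor_add_one _).le

theorem boxIndex_pos {l : ℝ} {L x : ℕ} (hx : 0 < x) : 1 ≤ (boxIndex l L x).val := by
  rw [boxIndex_val, if_neg hx.ne']
  exact le_max_left _ _

/-- On the logarithmic scale an interval has length at most `1`. This is the only source of error in
the algorithm. -/
theorem le_mul_of_boxIndex_eq {δ : ℝ} {L x y : ℕ} (hδ : 1 < δ) (hL : 0 < L) (hx : L ≤ x) (hy : L ≤ y)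
    (h : (boxIndex (Real.log δ) L x).val = (boxIndex (Real.log δ) L y).val) :
    (y : ℝ) ≤ δ * x := by
  rw [boxIndex_val, boxIndex_val, if_neg (by omega), if_neg (by omega)] at h
  have hl := Real.log_pos hδ
  have hL0 : (0 : ℝ) < L := by exact_mod_cast hL
  have hx0 : (0 : ℝ) < x := by exact_mod_cast hL.trans_le hx
  have hy0 : (0 : ℝ) < y := by exact_mod_cast hL.trans_le hy
  have hxL : (1 : ℝ) ≤ x / L := by rw [one_le_div hL0]; exact_mod_cast hx
  have hu : 0 ≤ Real.log (x / L) / Real.log δ := div_nonneg (Real.log_nonneg hxL) hl.le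
  have key : Real.log (y / L) / Real.log δ ≤ Real.log (x / L) / Real.log δ + 1 := by
    generalize Real.log (x / L) / Real.log δ = u at *
    generalize Real.log (y / L) / Real.log δ = v at *
    -- Indices `0` and `1` of the ceiling are merged by `max 1`. In that case `v ≤ 1 ≤ u + 1`;
    -- otherwise the two ceilings agree.
    rcases Nat.lt_or_ge 1 ⌈v⌉₊ with hv | hv
    · have h1 := Nat.le_ceil v
      have h2 := Nat.ceil_lt_add_one hu
      have : ⌈v⌉₊ = ⌈u⌉₊ := by omega
      rw [this] at h1
      linarith
    · have := Nat.ceil_le.1 hv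
      push_cast at this
      linarith
  rw [div_add_one hl.ne', div_le_div_iff_of_pos_right hl, ← Real.log_mul (by positivity) (by positivity),
    Real.log_le_log_iff (by positivity) (by positivity), div_mul_eq_mul_div,
    div_le_div_iff_of_pos_right hL0] at key
  linarith

/-- The box of a quadruple. -/
noncomputable def boxOf (g : Grid) (q : Quad) : ℕ × ℕ × ℕ :=
  ((boxIndex g.logδ g.L₁ q.l1).val, (boxIndex g.logδ g.L₂ q.l2).val, (boxIndex g.logδ g.L₃ q.Z).val)

/-- Every box is empty or holds a quadruple that belongs there and has the property `p`. -/
def Stored (g : Grid) (p : Quad → Prop) (B : Boxes) : Prop :=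
  ∀ b q, B b = some q → boxOf g q = b ∧ p q

/-- The box `b` holds a quadruple with `ℓ¹ ≤ v`. -/
def Holds (b : ℕ × ℕ × ℕ) (v : ℕ) (B : Boxes) : Prop := ∃ q, B b = some q ∧ q.l1 ≤ v

theorem stored_empty (g : Grid) (p : Quad → Prop) : Stored g p (emptyBoxes g).val :=
  fun _ _ h => by simp [emptyBoxes] at h

/-- The two outcomes contain all that is used about saving: an overwritten entry had a larger `ℓ¹`,
and a discarded quadruple is dominated by the occupant. Hence `Holds`, once true, persists. -/
theorem save_val (g : Grid) (B : Boxes) (q : Quad) :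
    ((save g B q).val = Function.update B (boxOf g q) (some q) ∧
        ∀ q', B (boxOf g q) = some q' → q.l1 < q'.l1) ∨
      (save g B q).val = B ∧ Holds (boxOf g q) q.l1 B := by
  have e : (save g B q).val = (match B (boxOf g q) with
      | none => writeBox B (boxOf g q) q
      | some q' => (do
        let smaller ← ltN q.l1 q'.l1
        if smaller then writeBox B (boxOf g q) q else pure B)).val := rfl
  rw [e]
  cases hb : B (boxOf g q) with
  | none => exact Or.inl ⟨rfl, by simp⟩
  | some q' =>
    by_cases h : q.l1 < q'.l1
    · left; simp [ltN, h, writeBox]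
    · right; simpa [ltN, h] using ⟨q', hb, not_lt.1 h⟩

theorem Stored.save {g : Grid} {p : Quad → Prop} {B : Boxes} {q : Quad} (h : Stored g p B) (hq : p q) :
    Stored g p (save g B q).val := by
  rcases save_val g B q with ⟨e, -⟩ | ⟨e, -⟩
  · rw [e]
    intro b q' hb
    by_cases hbq : b = boxOf g q
    · subst hbq
      rw [Function.update_self, Option.some_inj] at hb
      subst hb
      exact ⟨rfl, hq⟩
    · rw [Function.update_of_ne hbq] at hb
      exact h b q' hb
  · rwa [e]

theorem holds_save (g : Grid) (B : Boxes) (q : Quad) : Holds (boxOf g q) q.l1 (save g B q).val := by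
  rcases save_val g B q with ⟨e, -⟩ | ⟨e, h⟩
  · exact ⟨q, by rw [e, Function.update_self], le_rfl⟩
  · rwa [e]

theorem Holds.save {b : ℕ × ℕ × ℕ} {v : ℕ} {B : Boxes} (h : Holds b v B) (g : Grid) (q : Quad) :
    Holds b v (save g B q).val := by
  rcases save_val g B q with ⟨e, hlt⟩ | ⟨e, -⟩
  · obtain ⟨q', h1, h2⟩ := h
    by_cases hb : b = boxOf g q
    · subst hb
      exact ⟨q, by rw [e, Function.update_self], (hlt q' h1).le.trans h2⟩
    · exact ⟨q', by rw [e, Function.update_of_ne hb, h1], h2⟩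
  · rwa [e]

theorem save_steps (g : Grid) (B : Boxes) (q : Quad) : (save g B q).steps ≤ 30 := by
  have hb : ∀ l L x, (boxIndex l L x).steps ≤ 8 := by
    intro l L x
    by_cases hx : x = 0 <;> simp [boxIndex, eqN, toR, divR, logR, ceilR, maxN, hx]
  have h1 := hb g.logδ g.L₁ q.l1
  have h2 := hb g.logδ g.L₂ q.l2
  have h3 := hb g.logδ g.L₃ q.Z
  have e : (save g B q).steps = (boxIndex g.logδ g.L₁ q.l1).steps +
      ((boxIndex g.logδ g.L₂ q.l2).steps + ((boxIndex g.logδ g.L₃ q.Z).steps + (1 +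
      (match B (boxOf g q) with
      | none => writeBox B (boxOf g q) q
      | some q' => (do
        let smaller ← ltN q.l1 q'.l1
        if smaller then writeBox B (boxOf g q) q else pure B)).steps))) := rfl
  rw [e]
  have h4 : (match B (boxOf g q) with
      | none => writeBox B (boxOf g q) q
      | some q' => (do
        let smaller ← ltN q.l1 q'.l1
        if smaller then writeBox B (boxOf g q) q else pure B)).steps ≤ 2 := by
    cases hb : B (boxOf g q) with
    | none => simp [writeBox]
    | some q' => by_cases h : q.l1 < q'.l1 <;> simp [ltN, h, writeBox]
  omega

/-! ### Lower bounds on the cost of a schedule -/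

/-- Total processing time of the jobs among `J_1, …, J_i` outside `L`. -/
def earlyEnd (I : Problem) (L : Finset ℕ) (i : ℕ) : ℕ := ∑ l ∈ Icc 1 i with l ∉ L, I.p l

/-- Completion time of the jobs among `J_1, …, J_i` in `L`, processed from `T₂` on. -/
def lateEnd (I : Problem) (L : Finset ℕ) (i : ℕ) : ℕ := I.T₂ + ∑ l ∈ Icc 1 i with l ∈ L, I.p l

/-- A lower bound on the completion time of `J_i` when exactly the jobs in `L` are late: jobs are
processed without idle time in the order of their numbers, except that the early jobs after `J_j`
complete as soon as the deviation bound permits. -/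
def refCompl (I : Problem) (L : Finset ℕ) (j i : ℕ) : ℕ :=
  if i ∈ L then lateEnd I L i else if i ≤ j then earlyEnd I L i else I.pre i - I.k

theorem filter_Icc_succ (q : ℕ → Prop) [DecidablePred q] (f : ℕ → ℕ) (i : ℕ) :
    ∑ l ∈ Icc 1 (i + 1) with q l, f l = ∑ l ∈ Icc 1 i with q l, f l + if q (i + 1) then f (i + 1) else 0 := by
  rw [sum_filter, sum_Icc_succ_top (by omega), ← sum_filter]

theorem earlyEnd_succ_of_mem {I : Problem} {L : Finset ℕ} {i : ℕ} (h : i + 1 ∈ L) :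
    earlyEnd I L (i + 1) = earlyEnd I L i := by
  rw [earlyEnd, filter_Icc_succ, if_neg (by simpa using h)]; rfl

theorem earlyEnd_succ_of_notMem {I : Problem} {L : Finset ℕ} {i : ℕ} (h : i + 1 ∉ L) :
    earlyEnd I L (i + 1) = earlyEnd I L i + I.p (i + 1) := by
  rw [earlyEnd, filter_Icc_succ, if_pos h]; rfl

theorem lateEnd_succ_of_mem {I : Problem} {L : Finset ℕ} {i : ℕ} (h : i + 1 ∈ L) :
    lateEnd I L (i + 1) = lateEnd I L i + I.p (i + 1) := by
  rw [lateEnd, filter_Icc_succ, if_pos h, ← add_assoc]; rfl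

theorem lateEnd_succ_of_notMem {I : Problem} {L : Finset ℕ} {i : ℕ} (h : i + 1 ∉ L) :
    lateEnd I L (i + 1) = lateEnd I L i := by
  rw [lateEnd, filter_Icc_succ, if_neg h]; rfl

theorem lateEnd_mono (I : Problem) (L : Finset ℕ) : Monotone (lateEnd I L) :=
  monotone_nat_of_le_succ fun i => by
    by_cases h : i + 1 ∈ L
    · rw [lateEnd_succ_of_mem h]; omega
    · rw [lateEnd_succ_of_notMem h]

theorem le_lateEnd (I : Problem) (L : Finset ℕ) (i : ℕ) : I.T₂ ≤ lateEnd I L i := Nat.le_add_right _ _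

theorem lateEnd_add_pre {I : Problem} {L : Finset ℕ} {m i : ℕ} (hmi : m ≤ i)
    (h : ∀ l, m < l → l ≤ i → l ∈ L) : lateEnd I L i + I.pre m = lateEnd I L m + I.pre i := by
  induction i, hmi using Nat.le_induction with
  | base => rfl
  | succ i hi ih =>
    have := ih fun l hl hl' => h l hl (by omega)
    rw [lateEnd_succ_of_mem (h _ (by omega) le_rfl), I.pre_succ]
    omega

theorem earlyEnd_eq_pre {I : Problem} {L : Finset ℕ} {i : ℕ} (h : ∀ l, 1 ≤ l → l ≤ i → l ∉ L) :
    earlyEnd I L i = I.pre i := by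
  rw [earlyEnd, filter_true_of_mem fun l hl => h l (mem_Icc.1 hl).1 (mem_Icc.1 hl).2]; rfl

theorem lateEnd_eq {I : Problem} {L : Finset ℕ} {i : ℕ} (h : ∀ l, 1 ≤ l → l ≤ i → l ∉ L) :
    lateEnd I L i = I.T₂ := by
  rw [lateEnd, filter_false_of_mem fun l hl => h l (mem_Icc.1 hl).1 (mem_Icc.1 hl).2]; rfl

/-- The set `L` of late jobs, with first element `a`, is one that the algorithm can choose, and `V`
is an upper bound on the associated lower bounds on the cost. -/
structure Reference (I : Problem) (L : Finset ℕ) (a : ℕ) (V : ℝ) : Prop where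
  mem : a ∈ L
  notMem : ∀ i, 1 ≤ i → i < a → i ∉ L
  early : ∀ i, 1 ≤ i → i ≤ I.n → i ∉ L → earlyEnd I L i ≤ I.T₁ ∧ I.pre i ≤ I.T₁ + I.k
  cost : ∀ j ≤ I.n, ((∑ i ∈ Icc 1 I.n, I.w i * refCompl I L j i : ℕ) : ℝ) ≤ V

/-- `J_a` may start at `T₂` as the first late job. -/
structure Admissible (I : Problem) (a : ℕ) : Prop where
  pos : 1 ≤ a
  le : a ≤ I.n
  pre_le : I.pre (a - 1) ≤ I.T₁
  dev_le : I.T₂ ≤ I.pre (a - 1) + I.k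

/-! ### Construction of references -/

theorem Problem.Valid.ratio {I : Problem} (h : I.Valid) {i j : ℕ} (hi : i ∈ I.jobs) (hj : j ∈ I.jobs)
    (hij : i ≤ j) : I.p i * I.w j ≤ I.p j * I.w i := by
  have hwi : (0 : ℚ) < I.w i := by exact_mod_cast h.w_pos i hi
  have hwj : (0 : ℚ) < I.w j := by exact_mod_cast h.w_pos j hj
  have := h.wspt i hi j hj hij
  rw [div_le_div_iff₀ hwi hwj] at this
  exact_mod_cast this

theorem exists_reference_of_feasible {I : Problem} (h : I.Valid) {τ : ℕ → ℝ} (hτ : I.Feasible τ) :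
    ∃ L a, Admissible I a ∧ Reference I L a (I.objective τ) := by
  classical
  set L := I.jobs.filter fun i => (I.T₂ : ℝ) ≤ τ i with hL
  have hearly : ∀ i ∈ I.jobs, i ∉ L → τ i + I.p i ≤ I.T₁ := fun i hi hiL =>
    (hτ.available i hi).resolve_right fun h' => hiL (mem_filter.2 ⟨hi, h'⟩)
  -- Early jobs are packed into `[0, T₁]`. This shows that some job is late, that `P_{a-1} ≤ T₁`,
  -- and that the early load never exceeds `T₁`.
  have hfit : ∀ A ⊆ I.jobs, (∀ i ∈ A, i ∉ L) → ∑ i ∈ A, I.p i ≤ I.T₁ := by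
    intro A hA hAL
    have := sum_le_of_disjoint (σ := τ) (p := I.p) (t := 0) (T := I.T₁) A (by positivity)
      (fun i hi => h.p_pos i (hA hi)) (fun i hi j hj => hτ.disjoint i (hA hi) j (hA hj))
      (fun i hi => hτ.nonneg i (hA hi)) (fun i hi => hearly i (hA hi) (hAL i hi))
    rw [zero_add] at this
    exact_mod_cast this
  have hne : L.Nonempty := by
    rw [nonempty_iff_ne_empty]
    intro he
    have := hfit I.jobs subset_rfl (by simp [he])
    have := h.T₁_lt_P
    rw [Problem.totalP] at this
    omega
  set a := L.min' hne with ha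
  have haL : a ∈ L := L.min'_mem hne
  have hmin : ∀ i, i < a → i ∉ L := fun i hi hiL => absurd (L.min'_le i hiL) (by omega)
  obtain ⟨haj, haT⟩ := mem_filter.1 haL
  obtain ⟨ha1, ha2⟩ := mem_Icc.1 haj
  have hsub : ∀ i ≤ I.n, Icc 1 i ⊆ I.jobs := fun i hi => Icc_subset_Icc le_rfl hi
  refine ⟨L, a, ⟨ha1, ha2, ?_, ?_⟩, haL, fun i _ hi => hmin i hi, fun i hi hi' hiL => ⟨?_, ?_⟩, ?_⟩
  · exact hfit _ (hsub _ (by omega)) fun i hi => hmin i (by have := mem_Icc.1 hi; omega)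
  · have := (abs_le.1 (hτ.dev_le a haj)).2
    rw [I.planCompl_eq ha1, I.pre_sub_one ha1] at this
    push_cast at this
    have h2 : (I.T₂ : ℝ) ≤ I.pre (a - 1) + I.k := by linarith
    exact_mod_cast h2
  · exact hfit _ ((filter_subset _ _).trans (hsub i hi')) fun l hl => (mem_filter.1 hl).2
  · have hij : i ∈ I.jobs := mem_Icc.2 ⟨hi, hi'⟩
    have h1 := (abs_le.1 (hτ.dev_le i hij)).1
    have h2 := hearly i hij hiL
    rw [I.planCompl_eq hi] at h1
    have h3 : (I.pre i : ℝ) ≤ I.T₁ + I.k := by linarith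
    exact_mod_cast h3
  · intro j _
    -- Smith's rule is applied separately to the late jobs from `T₂` and to the early jobs up to `j`
    -- from `0`; the remaining early jobs are bounded by the deviation constraint alone.
    have smith : ∀ (q : ℕ → Prop) [DecidablePred q] (t : ℝ), (∀ i ∈ I.jobs, q i → t ≤ τ i) →
        ∑ i ∈ I.jobs with q i, (I.w i : ℝ) * (t + (∑ l ∈ I.jobs with q l ∧ l ≤ i, I.p l : ℕ)) ≤
          ∑ i ∈ I.jobs with q i, (I.w i : ℝ) * (τ i + I.p i) := by
      intro q _ t ht
      have hq : ∀ i ∈ I.jobs.filter q, i ∈ I.jobs := fun i hi => (mem_filter.1 hi).1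
      have := smith_le (σ := τ) (p := I.p) (w := I.w) (t := t) (I.jobs.filter q)
        (fun i hi => h.p_pos i (hq i hi)) (fun i hi j hj => h.ratio (hq i hi) (hq j hj))
        (fun i hi j hj => hτ.disjoint i (hq i hi) j (hq j hj))
        (fun i hi => ht i (hq i hi) (mem_filter.1 hi).2)
      simpa only [filter_filter, Nat.cast_sum] using this
    have hLate := smith (fun i => i ∈ L) I.T₂ fun i _ hi => (mem_filter.1 hi).2
    have hEarly := smith (fun i => i ∉ L ∧ i ≤ j) 0 fun i hi _ => hτ.nonneg i hi
    have hRest : ∑ i ∈ I.jobs with i ∉ L ∧ ¬ i ≤ j, (I.w i : ℝ) * ((I.pre i - I.k : ℕ) : ℝ) ≤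
        ∑ i ∈ I.jobs with i ∉ L ∧ ¬ i ≤ j, (I.w i : ℝ) * (τ i + I.p i) := by
      refine sum_le_sum fun i hi => mul_le_mul_of_nonneg_left ?_ (by positivity)
      have hij := (mem_filter.1 hi).1
      have h1 := (abs_le.1 (hτ.dev_le i hij)).1
      rw [I.planCompl_eq (mem_Icc.1 hij).1] at h1
      -- In `refCompl` the difference is truncated; when `k` exceeds `P_i` the bound reads `0` and
      -- holds by nonnegativity.
      rcases le_total I.k (I.pre i) with hk | hk
      · rw [Nat.cast_sub hk]
        linarith
      · rw [Nat.sub_eq_zero_of_le hk, Nat.cast_zero]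
        have := hτ.nonneg i hij
        positivity
    have split : ∀ f : ℕ → ℝ, ∑ i ∈ I.jobs, f i = ∑ i ∈ I.jobs with i ∈ L, f i +
        (∑ i ∈ I.jobs with i ∉ L ∧ i ≤ j, f i + ∑ i ∈ I.jobs with i ∉ L ∧ ¬ i ≤ j, f i) := by
      intro f
      rw [← sum_filter_add_sum_filter_not I.jobs (fun i => i ∈ L),
        ← sum_filter_add_sum_filter_not (I.jobs.filter fun i => i ∉ L) (fun i => i ≤ j),
        filter_filter, filter_filter]
    rw [Problem.objective, split, Nat.cast_sum]
    change ∑ i ∈ I.jobs, _ ≤ _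
    rw [split]
    refine add_le_add (le_trans (le_of_eq ?_) hLate) (add_le_add (le_trans (le_of_eq ?_) hEarly)
      (le_trans (le_of_eq ?_) hRest))
    · refine sum_congr rfl fun i hi => ?_
      obtain ⟨hi1, hi2⟩ := mem_filter.1 hi
      have hi1 := mem_Icc.1 hi1
      rw [refCompl, if_pos hi2, lateEnd]
      push_cast
      congr 3
      ext l
      simp only [mem_filter, mem_Icc, Problem.jobs]
      constructor
      · rintro ⟨⟨h1, h2⟩, h3⟩; exact ⟨⟨h1, by omega⟩, h3, h2⟩
      · rintro ⟨⟨h1, h2⟩, h3, h4⟩; exact ⟨⟨h1, h4⟩, h3⟩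
    · refine sum_congr rfl fun i hi => ?_
      obtain ⟨hi1, hi2, hi3⟩ := mem_filter.1 hi
      have hi1 := mem_Icc.1 hi1
      rw [refCompl, if_neg hi2, if_pos hi3, earlyEnd]
      push_cast
      rw [zero_add]
      congr 2
      ext l
      simp only [mem_filter, mem_Icc, Problem.jobs]
      constructor
      · rintro ⟨⟨h1, h2⟩, h3⟩; exact ⟨⟨h1, by omega⟩, ⟨h3, by omega⟩, h2⟩
      · rintro ⟨⟨h1, h2⟩, ⟨h3, _⟩, h4⟩; exact ⟨⟨h1, h4⟩, h3⟩
    · refine sum_congr rfl fun i hi => ?_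
      obtain ⟨hi1, hi2, hi3⟩ := mem_filter.1 hi
      rw [refCompl, if_neg hi2, if_neg hi3]
      push_cast
      rfl

/-- No feasible schedule is assumed here. The standing assumptions let all jobs from `firstHit` on
be late, and this reference forces the algorithm to return something. The value of `V` is
irrelevant: the sum over all `j` dominates each of the lower bounds. -/
theorem exists_reference {I : Problem} (h : I.Valid) : ∃ L a V, Admissible I a ∧ Reference I L a V := by
  have hn := h.n_pos
  have hne : {j | j ∈ I.jobs ∧ I.T₁ < I.planCompl j}.Nonempty :=
    ⟨I.n, by simp [Problem.jobs, hn], by rw [I.planCompl_eq hn]; exact h.T₁_lt_P⟩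
  have hmem := Nat.sInf_mem hne
  change I.firstHit ∈ _ at hmem
  obtain ⟨h1, h2⟩ := mem_Icc.1 hmem.1
  have hpre : I.pre (I.firstHit - 1) ≤ I.T₁ := by
    rcases Nat.lt_or_ge 1 I.firstHit with hlt | hge
    · by_contra hc
      have : I.firstHit ≤ I.firstHit - 1 := Nat.sInf_le
        ⟨mem_Icc.2 ⟨by omega, by omega⟩, by rw [I.planCompl_eq (by omega)]; omega⟩
      omega
    · rw [show I.firstHit - 1 = 0 by omega, I.pre_zero]; omega
  have hdev := h.dev_le
  rw [I.planStart_eq] at hdev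
  refine ⟨Icc I.firstHit I.n, I.firstHit,
    ∑ j ∈ range (I.n + 1), ((∑ i ∈ Icc 1 I.n, I.w i * refCompl I (Icc I.firstHit I.n) j i : ℕ) : ℝ),
    ⟨h1, h2, hpre, by omega⟩, by simp [h2], fun i _ hi => by simp; omega, fun i hi hi' hiL => ?_,
    fun j hj => ?_⟩
  · have hi2 : i < I.firstHit := by
      by_contra hc
      exact hiL (mem_Icc.2 ⟨by omega, hi'⟩)
    have := I.pre_mono (show i ≤ I.firstHit - 1 by omega)
    rw [earlyEnd_eq_pre fun l _ hl => by simp; omega]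
    omega
  · exact single_le_sum (f := fun j => ((∑ i ∈ Icc 1 I.n,
      I.w i * refCompl I (Icc I.firstHit I.n) j i : ℕ) : ℝ)) (fun _ _ => by positivity)
      (mem_range.2 (by omega))

/-! ### The transitions of the dynamic program -/

/-- Everything that `Approx(a, ε)` relies on. -/
structure Setup (I : Problem) (d : Prep) (g : Grid) (a : ℕ) (δ : ℝ) : Prop where
  valid : I.Valid
  prep : d.Correct I
  adm : Admissible I a
  one_lt : 1 < δ
  logδ : g.logδ = Real.log δ
  L₁ : g.L₁ = d.pmin
  L₂ : g.L₂ = I.T₂ + I.p a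
  L₃ : g.L₃ = I.preZ (a - 1) + I.w a * (I.T₂ + I.p a)
  r₁ : g.r₁ = (logRatio g.logδ g.L₁ I.T₁).val
  r₂ : g.r₂ = (logRatio g.logδ g.L₂ (I.T₂ + I.pre I.n)).val
  r₃ : g.r₃ = (logRatio g.logδ g.L₃ (I.preZ I.n + I.preW I.n * I.T₂)).val

theorem setup_makeGrid {I : Problem} {d : Prep} {a : ℕ} {ε : ℝ} (hI : I.Valid) (hd : d.Correct I)
    (ha : Admissible I a) (hε : 0 < ε) :
    Setup I d (makeGrid I d ε a).val a (1 + ε / (2 * I.n)) := by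
  have hn : (0 : ℝ) < I.n := by exact_mod_cast hI.n_pos
  have h1 := ha.le
  refine ⟨hI, hd, ha, by linarith [div_pos hε (mul_pos two_pos hn)], rfl, rfl, rfl, ?_, rfl, ?_, ?_⟩
  all_goals
    simp only [makeGrid, bind_val, pure_val, toR, mulR, divR, addR, logR, subN, readA, addN, mulN,
      hd.Z _ (show a - 1 ≤ I.n by omega), hd.Z _ le_rfl, hd.W _ le_rfl, hd.P _ le_rfl]

/-- A quadruple that describes a partial schedule of `J_1, …, J_j` without idle time. -/
structure Partial (I : Problem) (g : Grid) (a j : ℕ) (q : Quad) : Prop where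
  j_eq : q.j = j
  le : a ≤ j
  real : Realizes I q.blocks j q.l1 q.l2 q.Z
  sum : q.l1 + q.l2 = I.pre j + I.T₂
  pre_le : I.pre (a - 1) ≤ q.l1
  L₂_le : g.L₂ ≤ q.l2
  L₃_le : g.L₃ ≤ q.Z
  length : q.blocks.length ≤ j + 1

/-- A quadruple that describes a full schedule. -/
structure Full (I : Problem) (g : Grid) (q : Quad) : Prop where
  real : Realizes I q.blocks I.n q.l1 q.l2 q.Z
  L₂_le : g.L₂ ≤ q.l2
  L₃_le : g.L₃ ≤ q.Z
  length : q.blocks.length ≤ I.n + 3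

def laterQuad (I : Problem) (q : Quad) : Quad :=
  ⟨q.j + 1, q.l1, q.l2 + I.p (q.j + 1), q.Z + I.w (q.j + 1) * (q.l2 + I.p (q.j + 1)),
    (q.j + 1, q.l2) :: q.blocks⟩

def earlierQuad (I : Problem) (q : Quad) : Quad :=
  ⟨q.j + 1, q.l1 + I.p (q.j + 1), q.l2, q.Z + I.w (q.j + 1) * (q.l1 + I.p (q.j + 1)),
    (q.j + 1, q.l1) :: q.blocks⟩

/-- Under the condition of case 3, `ℓ¹ + k < P_j`, so the subtractions of `k` are genuine. -/
def idleQuad (I : Problem) (d : Prep) (q : Quad) : Quad :=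
  ⟨I.n, I.pre d.j₃ - I.k, q.l2 + (I.pre I.n - I.pre d.j₃),
    q.Z + I.seg q.j d.j₃ (I.pre q.j - I.k) + I.seg d.j₃ I.n q.l2,
    (I.n, q.l2) :: (d.j₃, I.pre q.j - I.k) :: q.blocks⟩

def completeQuad (I : Problem) (q : Quad) : Quad :=
  ⟨I.n, q.l1, q.l2 + (I.pre I.n - I.pre q.j), q.Z + I.seg q.j I.n q.l2, (I.n, q.l2) :: q.blocks⟩

theorem addLater_val (I : Problem) (g : Grid) (q : Quad) (B : Boxes) :
    (addLater I g q B).val = (save g B (laterQuad I q)).val := rfl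

theorem addEarlier_val {I : Problem} {d : Prep} (hd : d.Correct I) (g : Grid) (q : Quad) (B : Boxes)
    (hj : q.j + 1 ≤ I.n) :
    (addEarlier I d g q B).val =
      if q.l1 + I.p (q.j + 1) ≤ I.T₁ ∧ I.pre (q.j + 1) ≤ q.l1 + I.p (q.j + 1) + I.k then
        (save g B (earlierQuad I q)).val else B := by
  simp only [addEarlier, bind_val, addN, readA, leN, hd.P _ hj]
  by_cases h1 : q.l1 + I.p (q.j + 1) ≤ I.T₁ <;>
  by_cases h2 : I.pre (q.j + 1) ≤ q.l1 + I.p (q.j + 1) + I.k <;>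
  simp [h1, h2, mulN, consL, earlierQuad]

theorem addIdle_val {I : Problem} {d : Prep} (hd : d.Correct I) (g : Grid) (q : Quad) (B : Boxes)
    (hj : q.j + 1 ≤ I.n) :
    (addIdle I d g q B).val =
      if q.l1 + I.p (q.j + 1) + I.k < I.pre (q.j + 1) ∧ I.pre (q.j + 1) ≤ I.T₁ + I.k then
        (save g B (idleQuad I d q)).val else B := by
  have h3 := hd.j₃_le
  simp only [addIdle, bind_val, addN, readA, leN, ltN, subN, hd.P _ hj, hd.P _ (show q.j ≤ I.n by omega),
    hd.P _ h3, hd.P _ le_rfl]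
  by_cases h2 : I.pre (q.j + 1) ≤ I.T₁ + I.k
  · have := hd.le_j₃ _ hj h2
    by_cases h1 : q.l1 + I.p (q.j + 1) + I.k < I.pre (q.j + 1) <;>
    simp [h1, h2, consL, idleQuad, segment_val hd h3 le_rfl,
      segment_val hd (show q.j ≤ d.j₃ by omega) h3]
  · simp [h2]

theorem complete_val {I : Problem} {d : Prep} (hd : d.Correct I) (g : Grid) (q : Quad) (B : Boxes)
    (hj : q.j ≤ I.n) : (complete I d g q B).val = (save g B (completeQuad I q)).val := by
  simp only [complete, bind_val, addN, readA, subN, consL, hd.P _ hj, hd.P _ le_rfl,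
    segment_val hd hj le_rfl, completeQuad]

section

variable {I : Problem} {d : Prep} {g : Grid} {a j : ℕ} {δ : ℝ} {q : Quad}

theorem Setup.L₁_pos (S : Setup I d g a δ) : 0 < g.L₁ := by rw [S.L₁]; exact S.prep.pmin_pos

theorem Setup.T₂_pos (S : Setup I d g a δ) : 0 < I.T₂ := (Nat.zero_le _).trans_lt S.valid.T₁_lt_T₂

theorem Setup.L₂_pos (S : Setup I d g a δ) : 0 < g.L₂ := by
  have := S.T₂_pos
  rw [S.L₂]; omega

theorem Setup.L₃_pos (S : Setup I d g a δ) : 0 < g.L₃ := by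
  have := S.T₂_pos
  have hw := S.valid.w_pos a (mem_Icc.2 ⟨S.adm.pos, S.adm.le⟩)
  rw [S.L₃]
  positivity

/-- Ensures that the loops over the boxes visit every box that is occupied. -/
theorem Setup.inRange (S : Setup I d g a δ) {m : ℕ} (hm : m ≤ I.n)
    (hr : Realizes I q.blocks m q.l1 q.l2 q.Z) (h2 : g.L₂ ≤ q.l2) (h3 : g.L₃ ≤ q.Z) :
    g.InRange (boxOf g q) := by
  have hl : 0 < g.logδ := by rw [S.logδ]; exact Real.log_pos S.one_lt
  have hZ := hr.le_upper
  have hT := hr.1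
  have h1 := I.pre_mono hm
  have hZ' : q.Z ≤ I.preZ I.n + I.preW I.n * I.T₂ :=
    hZ.trans (Nat.add_le_add (I.preZ_mono hm) (Nat.mul_le_mul_right _ (I.preW_mono hm)))
  refine ⟨?_, ⟨?_, ?_⟩, ?_, ?_⟩
  · rw [S.r₁]; exact boxIndex_le hl S.L₁_pos hT.1
  · exact boxIndex_pos (S.L₂_pos.trans_le h2)
  · rw [S.r₂]; exact boxIndex_le hl S.L₂_pos (by omega)
  · exact boxIndex_pos (S.L₃_pos.trans_le h3)
  · rw [S.r₃]; exact boxIndex_le hl S.L₃_pos hZ'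

/-! ### Feasibility of the transitions -/

/-- Without idle time `ℓ¹ + ℓ² = P_j + T₂`. Since `ℓ¹ ≥ P_{a-1}` and `T₂ - P_{a-1} ≤ k`, this gives
`ℓ² ≤ P_j + k`, so appending late never violates the deviation bound; conversely `ℓ¹ ≤ T₁ < T₂`
gives `P_j < ℓ²`. -/
theorem Partial.later (S : Setup I d g a δ) (h : Partial I g a j q) :
    Partial I g a (j + 1) (laterQuad I q) := by
  obtain ⟨rfl, hle, hr, hs, hp, h2, h3, hlen⟩ := h
  have hT := S.valid.T₁_lt_T₂
  have hk := S.adm.dev_le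
  have hsucc := I.pre_succ q.j
  have h1 := hr.1
  refine ⟨rfl, by omega, ?_, ?_, hp, ?_, ?_, ?_⟩
  · rw [laterQuad, ← I.seg_succ]
    dsimp only
    exact hr.append (by omega) le_rfl (by omega) h1.1 (by omega) hT (Or.inr (by omega)) (by omega)
      (by omega) (by omega)
  all_goals simp only [laterQuad, List.length_cons]
  all_goals omega

theorem Partial.earlier (S : Setup I d g a δ) (h : Partial I g a j q)
    (hfit : q.l1 + I.p (q.j + 1) ≤ I.T₁)
    (hclose : I.pre (q.j + 1) ≤ q.l1 + I.p (q.j + 1) + I.k) :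
    Partial I g a (j + 1) (earlierQuad I q) := by
  obtain ⟨rfl, hle, hr, hs, hp, h2, h3, hlen⟩ := h
  have hT := S.valid.T₁_lt_T₂
  have hk := S.adm.dev_le
  have hsucc := I.pre_succ q.j
  have h1 := hr.1
  refine ⟨rfl, by omega, ?_, ?_, ?_, h2, ?_, ?_⟩
  · rw [earlierQuad, ← I.seg_succ]
    dsimp only
    exact hr.append (by omega) (by omega) le_rfl hfit (by omega) hT (Or.inl (by omega)) (by omega)
      (by omega) (by omega)
  all_goals simp only [earlierQuad, List.length_cons]
  all_goals omega

/-- `J_{j+1}, …, J_{j₃}` are exactly `k` ahead of `π*`. The gap condition says that `P_j - k` lies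
after `ℓ¹`, and the choice of `j₃` that the block ends by `T₁`. -/
theorem Partial.idle (S : Setup I d g a δ) (h : Partial I g a j q) (hj : j + 1 ≤ I.n)
    (hgap : q.l1 + I.p (q.j + 1) + I.k < I.pre (q.j + 1))
    (hfit : I.pre (q.j + 1) ≤ I.T₁ + I.k) : Full I g (idleQuad I d q) := by
  obtain ⟨rfl, hle, hr, hs, hp, h2, h3, hlen⟩ := h
  have hT := S.valid.T₁_lt_T₂
  have hk := S.adm.dev_le
  have hsucc := I.pre_succ q.j
  have h1 := hr.1
  have hj₃ := S.prep.le_j₃ _ hj hfit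
  have hpj := S.prep.pre_j₃_le
  have m1 := I.pre_mono (show q.j ≤ d.j₃ by omega)
  have m2 := I.pre_mono S.prep.j₃_le
  have r1 := hr.append (m' := d.j₃) (t := I.pre q.j - I.k) (l1' := I.pre d.j₃ - I.k) (l2' := q.l2)
    (by omega) (by omega) le_rfl (by omega) (by omega) hT (Or.inl (by omega)) (by omega) (by omega)
    (by omega)
  have r2 := r1.append (m' := I.n) (t := q.l2) (l1' := I.pre d.j₃ - I.k)
    (l2' := q.l2 + (I.pre I.n - I.pre d.j₃)) S.prep.j₃_le le_rfl (by omega) (by omega) (by omega) hT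
    (Or.inr (by omega)) (by omega) (by omega) (by omega)
  refine ⟨r2, ?_, ?_, ?_⟩
  all_goals simp only [idleQuad, List.length_cons]
  all_goals omega

theorem Partial.complete (S : Setup I d g a δ) (h : Partial I g a j q) (hj : j ≤ I.n) :
    Full I g (completeQuad I q) := by
  obtain ⟨rfl, hle, hr, hs, hp, h2, h3, hlen⟩ := h
  have hT := S.valid.T₁_lt_T₂
  have hk := S.adm.dev_le
  have h1 := hr.1
  have m1 := I.pre_mono hj
  have r := hr.append (m' := I.n) (t := q.l2) (l1' := q.l1)
    (l2' := q.l2 + (I.pre I.n - I.pre q.j)) hj le_rfl (by omega) (by omega) (by omega) hT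
    (Or.inr (by omega)) (by omega) (by omega) (by omega)
  refine ⟨r, ?_, ?_, ?_⟩
  all_goals simp only [completeQuad, List.length_cons]
  all_goals omega

theorem startQuad_spec (S : Setup I d g a δ) :
    Partial I g a a (startQuad I d a).val ∧ (startQuad I d a).val.l1 = I.pre (a - 1) ∧
      (startQuad I d a).val.l2 = I.T₂ + I.p a ∧
      (startQuad I d a).val.Z = I.preZ (a - 1) + I.w a * (I.T₂ + I.p a) := by
  have h1 := S.adm.pos
  have h2 := S.adm.le
  have e : (startQuad I d a).val = ⟨a, I.pre (a - 1), I.T₂ + I.p a,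
      I.preZ (a - 1) + I.w a * (I.T₂ + I.p a), [(a, I.T₂), (a - 1, 0)]⟩ := by
    simp only [startQuad, bind_val, pure_val, subN, readA, addN, mulN, consL,
      S.prep.P _ (show a - 1 ≤ I.n by omega), S.prep.Z _ (show a - 1 ≤ I.n by omega)]
  have hp := I.pre_sub_one h1
  have hT := S.valid.T₁_lt_T₂
  have ha := S.adm.pre_le
  have hk := S.adm.dev_le
  have r1 := (realizes_nil I).append (m' := a - 1) (t := 0) (l1' := I.pre (a - 1)) (l2' := I.T₂)
    (by omega) (by omega) le_rfl ha (by omega) hT (Or.inl (by simp)) (by omega) (by simp) (by omega)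
  have r2 := r1.append (m' := a) (t := I.T₂) (l1' := I.pre (a - 1)) (l2' := I.T₂ + I.p a)
    (by omega) le_rfl (by omega) ha (by omega) hT (Or.inr (by omega)) hk (by omega) (by omega)
  have z1 : I.seg 0 (a - 1) 0 = I.preZ (a - 1) := by
    simp only [Problem.seg, Problem.preZ, Problem.pre_zero]
    exact sum_congr rfl fun _ _ => by simp
  have z2 := I.seg_succ (a - 1) I.T₂
  rw [Nat.sub_add_cancel h1] at z2
  rw [z1, z2, zero_add] at r2
  rw [e]
  -- The start consists of two blocks, and `2 ≤ a + 1` since `a ≥ 1`.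
  refine ⟨⟨rfl, le_rfl, r2, ?_, le_rfl, ?_, ?_, ?_⟩, rfl, rfl, rfl⟩
  · simp only; omega
  · rw [S.L₂]
  · rw [S.L₃]
  · simp only [List.length_cons, List.length_nil]; omega

/-! ### Approximation of a reference by the kept quadruples -/

/-- The part of the lower bound that is due to `J_1, …, J_j`. -/
def refZ (I : Problem) (L : Finset ℕ) (j : ℕ) : ℕ := ∑ i ∈ Icc 1 j, I.w i * refCompl I L j i

theorem refCompl_congr {L : Finset ℕ} {i j j' : ℕ} (h : i ≤ j) (h' : i ≤ j') :
    refCompl I L j i = refCompl I L j' i := by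
  simp only [refCompl, if_pos h, if_pos h']

theorem refZ_eq {L : Finset ℕ} {m j : ℕ} (h : m ≤ j) :
    refZ I L m = ∑ i ∈ Icc 1 m, I.w i * refCompl I L j i :=
  sum_congr rfl fun i hi => by
    have := mem_Icc.1 hi
    rw [refCompl_congr this.2 (this.2.trans h)]

theorem refZ_succ (L : Finset ℕ) (m : ℕ) :
    refZ I L (m + 1) = refZ I L m + I.w (m + 1) * refCompl I L (m + 1) (m + 1) := by
  rw [refZ_eq (Nat.le_succ m), refZ, sum_Icc_succ_top (by omega)]

/-- `q` is at most as expensive as the reference on `J_1, …, J_j`, up to the factor `D`. -/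
structure Approximates (I : Problem) (L : Finset ℕ) (D : ℝ) (j : ℕ) (q : Quad) : Prop where
  l1 : q.l1 ≤ earlyEnd I L j
  l2 : (q.l2 : ℝ) ≤ D * lateEnd I L j
  Z : (q.Z : ℝ) ≤ D * refZ I L j

variable {L : Finset ℕ} {D V : ℝ}

theorem Approximates.later (hD : 1 ≤ D) (h : Approximates I L D q.j q) (hL : q.j + 1 ∈ L) :
    Approximates I L D (q.j + 1) (laterQuad I q) := by
  have h2 : ((q.l2 + I.p (q.j + 1) : ℕ) : ℝ) ≤ D * lateEnd I L (q.j + 1) := by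
    rw [lateEnd_succ_of_mem hL]
    push_cast
    nlinarith [h.l2, (I.p (q.j + 1)).cast_nonneg (α := ℝ)]
  refine ⟨?_, h2, ?_⟩
  · rw [earlyEnd_succ_of_mem hL]; exact h.l1
  · rw [refZ_succ, refCompl, if_pos hL, laterQuad]
    have := mul_le_mul_of_nonneg_left h2 (I.w (q.j + 1)).cast_nonneg
    push_cast at this ⊢
    linarith [h.Z]

theorem Approximates.earlier (hD : 1 ≤ D) (h : Approximates I L D q.j q) (hL : q.j + 1 ∉ L) :
    Approximates I L D (q.j + 1) (earlierQuad I q) := by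
  have h1 : q.l1 + I.p (q.j + 1) ≤ earlyEnd I L (q.j + 1) := by
    rw [earlyEnd_succ_of_notMem hL]
    exact Nat.add_le_add_right h.l1 _
  refine ⟨h1, ?_, ?_⟩
  · rw [lateEnd_succ_of_notMem hL]; exact h.l2
  · rw [refZ_succ, refCompl, if_neg hL, if_pos le_rfl, earlierQuad]
    have h2 : ((q.l1 + I.p (q.j + 1) : ℕ) : ℝ) ≤ D * earlyEnd I L (q.j + 1) := by
      have : ((q.l1 + I.p (q.j + 1) : ℕ) : ℝ) ≤ earlyEnd I L (q.j + 1) := by exact_mod_cast h1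
      nlinarith [(earlyEnd I L (q.j + 1)).cast_nonneg (α := ℝ)]
    have := mul_le_mul_of_nonneg_left h2 (I.w (q.j + 1)).cast_nonneg
    push_cast at this ⊢
    linarith [h.Z]

theorem seg_le {f : ℕ → ℕ} {i m t : ℕ}
    (h : ∀ l, i < l → l ≤ m → ((t + (I.pre l - I.pre i) : ℕ) : ℝ) ≤ D * f l) :
    (I.seg i m t : ℝ) ≤ D * ((∑ l ∈ Ioc i m, I.w l * f l : ℕ) : ℝ) := by
  rw [Problem.seg, Nat.cast_sum, Nat.cast_sum, mul_sum]
  refine sum_le_sum fun l hl => ?_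
  have hl := mem_Ioc.1 hl
  have := mul_le_mul_of_nonneg_left (h l hl.1 hl.2) (I.w l).cast_nonneg
  push_cast at this ⊢
  linarith

/-- An early job must satisfy `P_l - k ≤ T₁`, which fails beyond `j₃`. -/
theorem Reference.mem_of_j₃_lt (S : Setup I d g a δ) (R : Reference I L a V) {l : ℕ} (h : d.j₃ < l)
    (hl : l ≤ I.n) : l ∈ L := by
  by_contra hc
  have := S.prep.le_j₃ l hl (R.early l (by omega) hl hc).2
  omega

/-- The reference is used with the very `j` at which the idle time is inserted. Jobs of `L` up to
`j₃` are processed early here, which only helps: they complete at `P_l - k ≤ T₁`, before `T₂`. The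
jobs after `j₃` are late on both sides. -/
theorem Approximates.idle (S : Setup I d g a δ) (R : Reference I L a V) (hD : 1 ≤ D)
    (h : Approximates I L D q.j q) (hj : q.j + 1 ≤ d.j₃) (hk : I.k ≤ I.pre q.j) :
    ((idleQuad I d q).Z : ℝ) ≤ D * V := by
  have hn := S.prep.j₃_le
  have hT := S.valid.T₁_lt_T₂
  have hc := R.cost q.j (by omega)
  rw [← Problem.sum_Icc_add_sum_Ioc _ (show q.j ≤ I.n by omega),
    ← sum_Ioc_consecutive _ (show q.j ≤ d.j₃ by omega) hn, ← refZ] at hc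
  have h1 : (I.seg q.j d.j₃ (I.pre q.j - I.k) : ℝ) ≤
      D * ((∑ l ∈ Ioc q.j d.j₃, I.w l * refCompl I L q.j l : ℕ) : ℝ) := by
    refine seg_le fun l hl hl' => ?_
    have m1 := I.pre_mono hl.le
    have m2 := I.pre_mono hl'
    have m3 := S.prep.pre_j₃_le
    have : I.pre q.j - I.k + (I.pre l - I.pre q.j) ≤ refCompl I L q.j l := by
      rw [refCompl]
      split_ifs
      · have := le_lateEnd I L l
        omega
      · omega
      · omega
    have : ((I.pre q.j - I.k + (I.pre l - I.pre q.j) : ℕ) : ℝ) ≤ refCompl I L q.j l := by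
      exact_mod_cast this
    nlinarith [(refCompl I L q.j l).cast_nonneg (α := ℝ)]
  have h2 : (I.seg d.j₃ I.n q.l2 : ℝ) ≤
      D * ((∑ l ∈ Ioc d.j₃ I.n, I.w l * refCompl I L q.j l : ℕ) : ℝ) := by
    refine seg_le fun l hl hl' => ?_
    rw [refCompl, if_pos (R.mem_of_j₃_lt S hl hl')]
    have e := lateEnd_add_pre (I := I) (L := L) hl.le fun i hi hi' =>
      R.mem_of_j₃_lt S hi (hi'.trans hl')
    have m1 := lateEnd_mono I L (show q.j ≤ d.j₃ by omega)
    have m2 := I.pre_mono hl.le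
    have : lateEnd I L q.j + (I.pre l - I.pre d.j₃) ≤ lateEnd I L l := by omega
    have : (lateEnd I L q.j : ℝ) + (I.pre l - I.pre d.j₃ : ℕ) ≤ lateEnd I L l := by exact_mod_cast this
    push_cast
    nlinarith [h.l2, (I.pre l - I.pre d.j₃).cast_nonneg (α := ℝ)]
  have h3 := mul_le_mul_of_nonneg_left hc (zero_le_one.trans hD)
  rw [idleQuad]
  push_cast at h3 h1 h2 ⊢
  linarith [h.Z]

/-- No idle time has been inserted, so the lower bound with `j = n` is the right one: all remaining
jobs are late in the reference as well. -/
theorem Approximates.complete (S : Setup I d g a δ) (R : Reference I L a V) (hD : 1 ≤ D)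
    (h : Approximates I L D q.j q) (hj : d.j₃ ≤ q.j) (hj' : q.j ≤ I.n) :
    ((completeQuad I q).Z : ℝ) ≤ D * V := by
  have hc := R.cost I.n le_rfl
  rw [← Problem.sum_Icc_add_sum_Ioc _ hj', ← refZ_eq hj'] at hc
  have h2 : (I.seg q.j I.n q.l2 : ℝ) ≤
      D * ((∑ l ∈ Ioc q.j I.n, I.w l * refCompl I L I.n l : ℕ) : ℝ) := by
    refine seg_le fun l hl hl' => ?_
    rw [refCompl, if_pos (R.mem_of_j₃_lt S (hj.trans_lt hl) hl')]
    have e := lateEnd_add_pre (I := I) (L := L) hl.le fun i hi hi' =>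
      R.mem_of_j₃_lt S (hj.trans_lt hi) (hi'.trans hl')
    have m2 := I.pre_mono hl.le
    have : lateEnd I L q.j + (I.pre l - I.pre q.j) ≤ lateEnd I L l := by omega
    have : (lateEnd I L q.j : ℝ) + (I.pre l - I.pre q.j : ℕ) ≤ lateEnd I L l := by exact_mod_cast this
    push_cast
    nlinarith [h.l2, (I.pre l - I.pre q.j).cast_nonneg (α := ℝ)]
  have h3 := mul_le_mul_of_nonneg_left hc (zero_le_one.trans hD)
  rw [completeQuad]
  push_cast at h3 h2 ⊢
  linarith [h.Z]

theorem approximates_startQuad (S : Setup I d g a δ) (R : Reference I L a V) :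
    Approximates I L 1 a (startQuad I d a).val := by
  obtain ⟨-, h1, h2, h3⟩ := startQuad_spec S
  have ha := S.adm.pos
  have hL : a - 1 + 1 ∈ L := by rw [Nat.sub_add_cancel ha]; exact R.mem
  have hn : ∀ i, 1 ≤ i → i ≤ a - 1 → i ∉ L := fun i hi hi' => R.notMem i hi (by omega)
  have e1 := earlyEnd_succ_of_mem (I := I) hL
  have e2 := lateEnd_succ_of_mem (I := I) hL
  have e3 := refZ_succ (I := I) L (a - 1)
  rw [refCompl, if_pos hL] at e3
  rw [Nat.sub_add_cancel ha] at e1 e2 e3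
  rw [earlyEnd_eq_pre hn] at e1
  rw [lateEnd_eq hn] at e2
  have e4 : refZ I L (a - 1) = I.preZ (a - 1) := by
    refine sum_congr rfl fun i hi => ?_
    have hi := mem_Icc.1 hi
    rw [refCompl, if_neg (hn i hi.1 hi.2), if_pos hi.2,
      earlyEnd_eq_pre fun l hl hl' => hn l hl (hl'.trans hi.2)]
  rw [e2, e4] at e3
  refine ⟨?_, ?_, ?_⟩
  · rw [h1, e1]
  · rw [h2, e2, one_mul]
  · rw [h3, e3, one_mul]

/-- Replacing a quadruple by the survivor of its box costs a factor `δ` in `ℓ²` and `Z` and nothing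
in `ℓ¹`. -/
theorem Approximates.of_boxOf_eq (S : Setup I d g a δ) {q q' : Quad}
    (h : Approximates I L D j q)
    (h2 : g.L₂ ≤ q.l2) (h3 : g.L₃ ≤ q.Z) (h2' : g.L₂ ≤ q'.l2) (h3' : g.L₃ ≤ q'.Z)
    (hbox : boxOf g q = boxOf g q') (hl : q'.l1 ≤ q.l1) : Approximates I L (D * δ) j q' := by
  have hδ := zero_lt_one.trans S.one_lt
  simp only [boxOf, Prod.mk.injEq, S.logδ] at hbox
  have k2 := le_mul_of_boxIndex_eq S.one_lt S.L₂_pos h2 h2' hbox.2.1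
  have k3 := le_mul_of_boxIndex_eq S.one_lt S.L₃_pos h3 h3' hbox.2.2
  refine ⟨hl.trans h.l1, ?_, ?_⟩
  · nlinarith [mul_le_mul_of_nonneg_left h.l2 hδ.le]
  · nlinarith [mul_le_mul_of_nonneg_left h.Z hδ.le]

end

/-! ### The value of the dynamic program -/

/-- The treatment of one quadruple in the main loop of `Approx(a, ε)`. -/
noncomputable def expand (I : Problem) (d : Prep) (g : Grid) (q : Quad) (nf : Boxes × Boxes) :
    Timed (Boxes × Boxes) := do
  let next₁ ← addLater I g q nf.1
  let next₂ ← addEarlier I d g q next₁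
  let full₁ ← addIdle I d g q nf.2
  pure (next₂, full₁)

/-- One iteration of the main loop of `Approx(a, ε)`. -/
noncomputable def stage (I : Problem) (d : Prep) (g : Grid) (st : Boxes × Boxes) :
    Timed (Boxes × Boxes) := do
  let next₀ ← emptyBoxes g
  forBoxes g st.1 (next₀, st.2) fun q nf => expand I d g q nf

section

variable {I : Problem} {d : Prep} {g : Grid} {a j : ℕ} {δ V : ℝ} {L : Finset ℕ} {q : Quad}

/-- The boxes before the treatment of `J_{j+1}` hold what they should. -/
def Sound (I : Problem) (g : Grid) (a j : ℕ) (st : Boxes × Boxes) : Prop :=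
  Stored g (Partial I g a j) st.1 ∧ Stored g (Full I g) st.2

/-- A full schedule of cost at most `v` has been saved in `F`. -/
def Found (I : Problem) (g : Grid) (v : ℝ) (F : Boxes) : Prop :=
  ∃ q, Full I g q ∧ (q.Z : ℝ) ≤ v ∧ Holds (boxOf g q) q.l1 F

/-- A kept quadruple approximates the reference, or a good full schedule has been found. -/
def Covered (I : Problem) (g : Grid) (L : Finset ℕ) (a j : ℕ) (δ V : ℝ) (st : Boxes × Boxes) : Prop :=
  (∃ b q, st.1 b = some q ∧ Approximates I L (δ ^ (j - a)) j q) ∨ Found I g (δ ^ (I.n - 1) * V) st.2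

theorem expand_val_fst (hd : d.Correct I) (hj : q.j + 1 ≤ I.n) (nf : Boxes × Boxes) :
    (expand I d g q nf).val.1 =
      if q.l1 + I.p (q.j + 1) ≤ I.T₁ ∧ I.pre (q.j + 1) ≤ q.l1 + I.p (q.j + 1) + I.k then
        (save g (save g nf.1 (laterQuad I q)).val (earlierQuad I q)).val
      else (save g nf.1 (laterQuad I q)).val := by
  simp only [expand, bind_val, pure_val, addLater_val, addEarlier_val hd _ _ _ hj]

theorem expand_val_snd (hd : d.Correct I) (hj : q.j + 1 ≤ I.n) (nf : Boxes × Boxes) :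
    (expand I d g q nf).val.2 =
      if q.l1 + I.p (q.j + 1) + I.k < I.pre (q.j + 1) ∧ I.pre (q.j + 1) ≤ I.T₁ + I.k then
        (save g nf.2 (idleQuad I d q)).val else nf.2 := by
  simp only [expand, bind_val, pure_val, addIdle_val hd _ _ _ hj]

theorem Sound.expand (S : Setup I d g a δ) (hj : j + 1 ≤ I.n) (hq : Partial I g a j q)
    {nf : Boxes × Boxes} (h : Sound I g a (j + 1) nf) : Sound I g a (j + 1) (expand I d g q nf).val := by
  have hj' : q.j + 1 ≤ I.n := by rw [hq.j_eq]; exact hj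
  constructor
  · rw [expand_val_fst S.prep hj']
    have h1 := h.1.save (hq.later S)
    split_ifs with hc
    · exact h1.save (hq.earlier S hc.1 hc.2)
    · exact h1
  · rw [expand_val_snd S.prep hj']
    split_ifs with hc
    · exact h.2.save (hq.idle S hj hc.1 hc.2)
    · exact h.2

theorem Holds.expand_fst (hd : d.Correct I) (hj : q.j + 1 ≤ I.n) {nf : Boxes × Boxes}
    {b : ℕ × ℕ × ℕ} {v : ℕ} (h : Holds b v nf.1) : Holds b v (expand I d g q nf).val.1 := by
  rw [expand_val_fst hd hj]
  split_ifs
  · exact (h.save _ _).save _ _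
  · exact h.save _ _

theorem Holds.expand_snd (hd : d.Correct I) (hj : q.j + 1 ≤ I.n) {nf : Boxes × Boxes}
    {b : ℕ × ℕ × ℕ} {v : ℕ} (h : Holds b v nf.2) : Holds b v (expand I d g q nf).val.2 := by
  rw [expand_val_snd hd hj]
  split_ifs
  · exact h.save _ _
  · exact h

theorem Sound.stage (S : Setup I d g a δ) (hj : j + 1 ≤ I.n) {st : Boxes × Boxes}
    (h : Sound I g a j st) : Sound I g a (j + 1) (stage I d g st).val :=
  forBoxes_inv (Sound I g a (j + 1)) ⟨stored_empty _ _, h.2⟩ fun b q _ hb hnf =>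
    hnf.expand S hj (h.1 b q hb).2

theorem Covered.of_holds (S : Setup I d g a δ) {st : Boxes × Boxes} {D : ℝ}
    (hs : Sound I g a (j + 1) st) (hq : Partial I g a (j + 1) q) (ha : Approximates I L D (j + 1) q)
    (hD : D * δ = δ ^ (j + 1 - a)) (h : Holds (boxOf g q) q.l1 st.1) :
    Covered I g L a (j + 1) δ V st := by
  obtain ⟨q', hb, hl⟩ := h
  obtain ⟨hbox, hq'⟩ := hs.1 _ _ hb
  refine Or.inl ⟨_, q', hb, ?_⟩
  rw [← hD]
  exact ha.of_boxOf_eq S hq.L₂_le hq.L₃_le hq'.L₂_le hq'.L₃_le hbox.symm hl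

/-- The good quadruple follows `L`: it appends `J_{j+1}` late or early as `L` prescribes. The one
thing that can prevent this is an `ℓ¹` too small for the deviation bound, and then case 3 delivers a
full schedule within the required cost. -/
theorem Covered.stage (S : Setup I d g a δ) (R : Reference I L a V) (haj : a ≤ j) (hj : j + 1 ≤ d.j₃)
    {st : Boxes × Boxes} (h : Sound I g a j st) (hc : Covered I g L a j δ V st) :
    Covered I g L a (j + 1) δ V (stage I d g st).val := by
  have hn := S.prep.j₃_le
  have hjn : j + 1 ≤ I.n := by omega
  have hpj : ∀ b q, st.1 b = some q → q.j + 1 ≤ I.n := fun b q hb => by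
    rw [(h.1 b q hb).2.j_eq]; exact hjn
  have h0 : Sound I g a (j + 1) ((emptyBoxes g).val, st.2) := ⟨stored_empty _ _, h.2⟩
  have hs := h.stage S hjn
  rcases hc with ⟨b, q, hb, hq⟩ | ⟨q, h1, h2, h3⟩
  swap
  · refine Or.inr ⟨q, h1, h2, ?_⟩
    exact forBoxes_inv (fun nf : Boxes × Boxes => Holds (boxOf g q) q.l1 nf.2) h3 fun b' q' nf hb' hnf =>
      hnf.expand_snd S.prep (hpj b' q' hb')
  obtain ⟨-, hP⟩ := h.1 b q hb
  obtain ⟨hbox, -⟩ := h.1 b q hb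
  have hrange : g.InRange b := hbox ▸ S.inRange (show j ≤ I.n by omega) hP.real hP.L₂_le hP.L₃_le
  have hD : 1 ≤ δ ^ (j - a) := one_le_pow₀ S.one_lt.le
  have hDδ : δ ^ (j - a) * δ = δ ^ (j + 1 - a) := by rw [← pow_succ]; congr 1; omega
  have hjq := hP.j_eq
  have hq' : Approximates I L (δ ^ (j - a)) q.j q := by rw [hjq]; exact hq
  -- Whatever the expansion of `q` establishes is still true at the end of the stage, provided that
  -- the expansion of any other kept quadruple preserves it.
  have reach : ∀ Rr : Boxes × Boxes → Prop,
      (∀ nf, Sound I g a (j + 1) nf → Rr (expand I d g q nf).val) →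
      (∀ b' q' nf, st.1 b' = some q' → Rr nf → Rr (expand I d g q' nf).val) →
      Rr (Resched.stage I d g st).val := fun Rr hR hk =>
    forBoxes_reach (Sound I g a (j + 1)) Rr hrange hb h0
      (fun b' q' nf hb' hnf => hnf.expand S hjn (h.1 b' q' hb').2) hR
      fun b' q' nf hb' _ hr => hk b' q' nf hb' hr
  by_cases hL : j + 1 ∈ L
  · refine Covered.of_holds S hs (hP.later S) ?_ hDδ (reach
      (fun nf => Holds (boxOf g (laterQuad I q)) (laterQuad I q).l1 nf.1) (fun nf _ => ?_)
      fun b' q' nf hb' hr => hr.expand_fst S.prep (hpj b' q' hb'))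
    · subst hjq; exact hq'.later hD hL
    · rw [expand_val_fst S.prep (hpj b q hb)]
      split_ifs
      · exact (holds_save _ _ _).save _ _
      · exact holds_save _ _ _
  · obtain ⟨hT, hk⟩ := R.early (j + 1) (by omega) hjn hL
    have hl := hq.l1
    rw [earlyEnd_succ_of_notMem hL] at hT
    -- The exact inequality between `ℓ¹` and the early load of `L` is needed here; any factor above
    -- `1` could overshoot `T₁`.
    have hfit : q.l1 + I.p (q.j + 1) ≤ I.T₁ := by rw [hjq]; omega
    by_cases hclose : I.pre (q.j + 1) ≤ q.l1 + I.p (q.j + 1) + I.k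
    · refine Covered.of_holds S hs (hP.earlier S hfit hclose) ?_ hDδ (reach
        (fun nf => Holds (boxOf g (earlierQuad I q)) (earlierQuad I q).l1 nf.1) (fun nf _ => ?_)
        fun b' q' nf hb' hr => hr.expand_fst S.prep (hpj b' q' hb'))
      · subst hjq; exact hq'.earlier hD hL
      · rw [expand_val_fst S.prep (hpj b q hb), if_pos ⟨hfit, hclose⟩]
        exact holds_save _ _ _
    · have hgap := not_le.1 hclose
      have hk' : I.pre (q.j + 1) ≤ I.T₁ + I.k := by rw [hjq]; exact hk
      refine Or.inr ⟨idleQuad I d q, hP.idle S hjn hgap hk', ?_, reach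
        (fun nf => Holds (boxOf g (idleQuad I d q)) (idleQuad I d q).l1 nf.2) (fun nf _ => ?_)
        fun b' q' nf hb' hr => hr.expand_snd S.prep (hpj b' q' hb')⟩
      · have hpre := I.pre_succ q.j
        refine (hq'.idle S R hD (by omega) (by omega)).trans ?_
        -- Nonnegativity of `V`, read off from any of the lower bounds, allows the exponent `j - a`
        -- to be raised to `n - 1`.
        have hV : 0 ≤ V := le_trans (by positivity) (R.cost 0 (by omega))
        exact mul_le_mul_of_nonneg_right
          (pow_le_pow_right₀ S.one_lt.le (by have := S.adm.pos; omega)) hV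
      · rw [expand_val_snd S.prep (hpj b q hb), if_pos ⟨hgap, hk'⟩]
        exact holds_save _ _ _

/-- The main loop of `Approx(a, ε)`. -/
noncomputable def stages (I : Problem) (d : Prep) (g : Grid) (a : ℕ) : Timed (Boxes × Boxes) :=
  forRange a (d.j₃ - 1) ((save g (emptyBoxes g).val (startQuad I d a).val).val, (emptyBoxes g).val)
    fun _ st => stage I d g st

theorem approxAt_val (I : Problem) (d : Prep) (ε : ℝ) (a : ℕ) :
    (approxAt I d ε a).val =
      (let g := (makeGrid I d ε a).val
       let st := (stages I d g a).val
       (forBoxes g (forBoxes g st.1 st.2 fun q f => complete I d g q f).val (none : Option Quad)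
          fun q best => better q best).val) := rfl

theorem sound_start (S : Setup I d g a δ) : Sound I g a a
    ((save g (emptyBoxes g).val (startQuad I d a).val).val, (emptyBoxes g).val) :=
  ⟨(stored_empty _ _).save (startQuad_spec S).1, stored_empty _ _⟩

theorem max_stage (S : Setup I d g a δ) : max a (d.j₃ - 1 + 1) = max a d.j₃ := by
  have := S.adm.pos
  omega

theorem sound_stages (S : Setup I d g a δ) : Sound I g a (max a d.j₃) (stages I d g a).val := by
  rw [← max_stage S]
  refine forRange_inv (Sound I g a) (sound_start S) fun j st h1 h2 h => h.stage S ?_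
  have := S.prep.j₃_le
  have := S.adm.pos
  omega

theorem covered_stages (S : Setup I d g a δ) (R : Reference I L a V) :
    Covered I g L a (max a d.j₃) δ V (stages I d g a).val := by
  rw [← max_stage S]
  refine (forRange_inv (fun j st => Sound I g a j st ∧ Covered I g L a j δ V st)
    ⟨sound_start S, Or.inl ?_⟩ fun j st h1 h2 h => ?_).2
  · have he : (save g (emptyBoxes g).val (startQuad I d a).val).val =
        Function.update (emptyBoxes g).val (boxOf g (startQuad I d a).val)
          (some (startQuad I d a).val) := by
      -- The boxes are empty, so the first quadruple is stored unchanged and the exponent starts at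
      -- `0`.
      rcases save_val g (emptyBoxes g).val (startQuad I d a).val with ⟨e, -⟩ | ⟨-, q, hq, -⟩
      · exact e
      · simp [emptyBoxes] at hq
    refine ⟨boxOf g (startQuad I d a).val, (startQuad I d a).val, ?_, ?_⟩
    · rw [he]; exact Function.update_self _ _ _
    · rw [Nat.sub_self, pow_zero]
      exact approximates_startQuad S R
  · have := S.prep.j₃_le
    have := S.adm.pos
    exact ⟨h.1.stage S (by omega), h.2.stage S R h1 (by omega) h.1⟩

/-- The boxes of full schedules at the end of `Approx(a, ε)`. -/
noncomputable def fullBoxes (I : Problem) (d : Prep) (g : Grid) (a : ℕ) : Boxes :=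
  (forBoxes g (stages I d g a).val.1 (stages I d g a).val.2 fun q f => complete I d g q f).val

theorem stored_fullBoxes (S : Setup I d g a δ) : Stored g (Full I g) (fullBoxes I d g a) := by
  have hm : max a d.j₃ ≤ I.n := max_le S.adm.le S.prep.j₃_le
  have hs := sound_stages S
  refine forBoxes_inv (Stored g (Full I g)) hs.2 fun b q F hb hF => ?_
  have hP := (hs.1 b q hb).2
  rw [complete_val S.prep _ _ _ (hP.j_eq.trans_le hm)]
  exact hF.save (hP.complete S hm)

/-- The main loop ends at `max a j₃`, beyond which all jobs of the reference are late, so a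
surviving good quadruple may be completed late. -/
theorem found_fullBoxes (S : Setup I d g a δ) (R : Reference I L a V) :
    Found I g (δ ^ (I.n - 1) * V) (fullBoxes I d g a) := by
  have hm : max a d.j₃ ≤ I.n := max_le S.adm.le S.prep.j₃_le
  have hs := sound_stages S
  have hval : ∀ b q F, (stages I d g a).val.1 b = some q →
      (complete I d g q F).val = (save g F (completeQuad I q)).val := fun b q F hb =>
    complete_val S.prep _ _ _ ((hs.1 b q hb).2.j_eq.trans_le hm)
  have keep : ∀ b₀ v b q F, (stages I d g a).val.1 b = some q → Holds b₀ v F →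
      Holds b₀ v (complete I d g q F).val := fun b₀ v b q F hb hF => by
    rw [hval b q F hb]; exact hF.save _ _
  rcases covered_stages S R with ⟨b, q, hb, hq⟩ | ⟨q, h1, h2, h3⟩
  · obtain ⟨hbox, hP⟩ := hs.1 b q hb
    have hrange : g.InRange b := hbox ▸ S.inRange hm hP.real hP.L₂_le hP.L₃_le
    refine ⟨completeQuad I q, hP.complete S hm, ?_, forBoxes_reach (fun _ => True)
      (Holds (boxOf g (completeQuad I q)) (completeQuad I q).l1) hrange hb trivial
      (fun _ _ _ _ _ => trivial) (fun F _ => ?_) fun b' q' F hb' _ hF => keep _ _ b' q' F hb' hF⟩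
    · have hq' : Approximates I L (δ ^ (max a d.j₃ - a)) q.j q := by rw [hP.j_eq]; exact hq
      refine (hq'.complete S R (one_le_pow₀ S.one_lt.le) (by rw [hP.j_eq]; exact le_max_right _ _)
        (hP.j_eq.trans_le hm)).trans ?_
      have hV : 0 ≤ V := le_trans (by positivity) (R.cost 0 (by omega))
      exact mul_le_mul_of_nonneg_right
        (pow_le_pow_right₀ S.one_lt.le (by have := S.adm.pos; omega)) hV
    · rw [hval b q F hb]
      exact holds_save _ _ _
  · exact ⟨q, h1, h2, forBoxes_inv (Holds (boxOf g q) q.l1) h3 fun b' q' F hb' hF =>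
      keep _ _ b' q' F hb' hF⟩

/-! ### Selection of the cheapest full schedule -/

theorem better_val (q : Quad) (o : Option Quad) :
    ∃ q', (better q o).val = some q' ∧ (q' = q ∨ o = some q') ∧ q'.Z ≤ q.Z ∧
      ∀ q'', o = some q'' → q'.Z ≤ q''.Z := by
  cases o with
  | none => exact ⟨q, rfl, Or.inl rfl, le_rfl, by simp⟩
  | some q₀ =>
    by_cases h : q.Z < q₀.Z
    · exact ⟨q, by simp [better, ltN, h], Or.inl rfl, le_rfl, by rintro _ ⟨⟩; exact h.le⟩
    · exact ⟨q₀, by simp [better, ltN, h], Or.inr rfl, not_lt.1 h, by rintro _ ⟨⟩; exact le_rfl⟩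

/-- The option holds a quadruple of cost at most `v`. -/
def AtMost (v : ℝ) (o : Option Quad) : Prop := ∃ q, o = some q ∧ (q.Z : ℝ) ≤ v

theorem AtMost.better {v : ℝ} {o : Option Quad} (h : AtMost v o) (q : Quad) :
    AtMost v (better q o).val := by
  obtain ⟨q₀, rfl, h⟩ := h
  obtain ⟨q', h1, -, -, h4⟩ := better_val q (some q₀)
  exact ⟨q', h1, le_trans (by exact_mod_cast h4 _ rfl) h⟩

theorem atMost_better {v : ℝ} (o : Option Quad) (h : (q.Z : ℝ) ≤ v) : AtMost v (better q o).val := by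
  obtain ⟨q', h1, -, h3, -⟩ := better_val q o
  exact ⟨q', h1, le_trans (by exact_mod_cast h3) h⟩

/-- If the option holds a quadruple, then it describes a full schedule. -/
def IsSchedule (I : Problem) (o : Option Quad) : Prop :=
  ∀ q, o = some q → Realizes I q.blocks I.n q.l1 q.l2 q.Z ∧ q.blocks.length ≤ I.n + 3

theorem IsSchedule.better {o : Option Quad} (h : IsSchedule I o)
    (hq : Realizes I q.blocks I.n q.l1 q.l2 q.Z ∧ q.blocks.length ≤ I.n + 3) :
    IsSchedule I (better q o).val := by
  obtain ⟨q', h1, h2, -⟩ := better_val q o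
  intro q'' h''
  rw [h1, Option.some_inj] at h''
  subst h''
  rcases h2 with rfl | h2
  · exact hq
  · exact h _ h2

theorem isSchedule_approxAt {ε : ℝ} (S : Setup I d (makeGrid I d ε a).val a δ) :
    IsSchedule I (approxAt I d ε a).val := by
  rw [approxAt_val]
  refine forBoxes_inv (IsSchedule I) (fun q h => by simp at h) fun b q o hb ho => ho.better ?_
  have hq := (stored_fullBoxes S b q hb).2
  exact ⟨hq.real, hq.length⟩

/-- The good full schedule may have lost its box to one with smaller `ℓ¹`. The survivor has `Z`
larger by at most `δ`, whence the exponent `n` in place of `n - 1`. -/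
theorem atMost_approxAt {ε : ℝ} (S : Setup I d (makeGrid I d ε a).val a δ) (R : Reference I L a V) :
    AtMost (δ ^ I.n * V) (approxAt I d ε a).val := by
  rw [approxAt_val]
  obtain ⟨q, hF, hZ, q', hb, -⟩ := found_fullBoxes S R
  obtain ⟨hbox, hF'⟩ := stored_fullBoxes S _ q' hb
  refine forBoxes_reach (fun _ => True) (AtMost (δ ^ I.n * V))
    (hbox ▸ S.inRange le_rfl hF'.real hF'.L₂_le hF'.L₃_le) hb trivial (fun _ _ _ _ _ => trivial)
    (fun o _ => atMost_better o ?_) fun _ _ _ _ _ ho => ho.better _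
  simp only [boxOf, Prod.mk.injEq, S.logδ] at hbox
  have := le_mul_of_boxIndex_eq S.one_lt S.L₃_pos hF.L₃_le hF'.L₃_le hbox.2.2.symm
  have hδ := zero_lt_one.trans S.one_lt
  have hn : δ ^ I.n = δ * δ ^ (I.n - 1) := by
    rw [← pow_succ']; congr 1; have := S.valid.n_pos; omega
  rw [hn]
  nlinarith [mul_le_mul_of_nonneg_left hZ hδ.le]

end

/-! ### The number of steps -/

def Grid.boxes (g : Grid) : ℕ := (g.r₁ + 2) * (g.r₂ + 1) * (g.r₃ + 1)

theorem Grid.boxes_pos (g : Grid) : 1 ≤ g.boxes := Nat.succ_le_of_lt (by unfold Grid.boxes; positivity)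

theorem addLater_steps (I : Problem) (g : Grid) (q : Quad) (B : Boxes) :
    (addLater I g q B).steps ≤ 37 := by
  simp only [addLater, bind_steps, addN, readA, mulN, consL]
  have := fun q => save_steps g B q
  grind

theorem addEarlier_steps (I : Problem) (d : Prep) (g : Grid) (q : Quad) (B : Boxes) :
    (addEarlier I d g q B).steps ≤ 41 := by
  simp only [addEarlier, bind_steps, addN, readA, leN]
  split_ifs
  · simp only [bind_steps, mulN, consL]
    have := fun q => save_steps g B q
    grind
  · simp

theorem segment_steps (d : Prep) (i j t : ℕ) : (segment d i j t).steps = 11 := rfl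

theorem addIdle_steps (I : Problem) (d : Prep) (g : Grid) (q : Quad) (B : Boxes) :
    (addIdle I d g q B).steps ≤ 72 := by
  simp only [addIdle, bind_steps, addN, readA, leN, ltN]
  split_ifs
  · simp only [bind_steps, consL, subN, segment_steps]
    have := fun q => save_steps g B q
    grind
  · simp

theorem complete_steps (I : Problem) (d : Prep) (g : Grid) (q : Quad) (B : Boxes) :
    (complete I d g q B).steps ≤ 48 := by
  simp only [complete, bind_steps, addN, readA, subN, consL, segment_steps]
  have := fun q => save_steps g B q
  grind

theorem better_steps (q : Quad) (o : Option Quad) : (better q o).steps ≤ 1 := by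
  cases o with
  | none => simp [better]
  | some q₀ => by_cases h : q.Z < q₀.Z <;> simp [better, ltN, h]

theorem expand_steps (I : Problem) (d : Prep) (g : Grid) (q : Quad) (nf : Boxes × Boxes) :
    (expand I d g q nf).steps ≤ 150 := by
  have h1 := addLater_steps I g q nf.1
  have h2 := addEarlier_steps I d g q (addLater I g q nf.1).val
  have h3 := addIdle_steps I d g q nf.2
  have e : (expand I d g q nf).steps = (addLater I g q nf.1).steps +
    ((addEarlier I d g q (addLater I g q nf.1).val).steps + ((addIdle I d g q nf.2).steps + 0)) := rfl
  omega

theorem stage_steps (I : Problem) (d : Prep) (g : Grid) (st : Boxes × Boxes) :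
    (stage I d g st).steps ≤ 161 * g.boxes := by
  have h := forBoxes_steps (g := g) (B := st.1) (x := ((emptyBoxes g).val, st.2))
    (body := fun q nf => expand I d g q nf) fun q nf => expand_steps I d g q nf
  have e : (stage I d g st).steps = g.boxes +
    (forBoxes g st.1 ((emptyBoxes g).val, st.2) fun q nf => expand I d g q nf).steps := rfl
  rw [← Grid.boxes] at h
  omega

theorem makeGrid_steps (I : Problem) (d : Prep) (ε : ℝ) (a : ℕ) : (makeGrid I d ε a).steps = 36 := by
  simp [makeGrid, logRatio, toR, mulR, divR, addR, logR, subN, readA, addN, mulN, floorR]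

theorem startQuad_steps (I : Problem) (d : Prep) (a : ℕ) : (startQuad I d a).steps = 10 := rfl

theorem approxAt_steps {I : Problem} {d : Prep} (hd : d.Correct I) (hn : 1 ≤ I.n) (ε : ℝ) (a : ℕ) :
    (approxAt I d ε a).steps ≤ 400 * (I.n * (makeGrid I d ε a).val.boxes) := by
  have e : (approxAt I d ε a).steps = (makeGrid I d ε a).steps + (let g := (makeGrid I d ε a).val
    g.boxes + (g.boxes + ((startQuad I d a).steps +
    ((save g (emptyBoxes g).val (startQuad I d a).val).steps + (1 + ((stages I d g a).steps +
    ((forBoxes g (stages I d g a).val.1 (stages I d g a).val.2 fun q f => complete I d g q f).steps +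
      (forBoxes g (fullBoxes I d g a) (none : Option Quad) fun q best => better q best).steps))))))) := rfl
  rw [makeGrid_steps, startQuad_steps] at e
  generalize (makeGrid I d ε a).val = g at e ⊢
  dsimp only at e
  have h1 := save_steps g (emptyBoxes g).val (startQuad I d a).val
  have h2 : (stages I d g a).steps ≤ (d.j₃ - 1 + 1 - a) * (161 * g.boxes + 1) + 1 :=
    forRange_steps fun _ st _ _ => stage_steps I d g st
  have h3 := forBoxes_steps (g := g) (B := (stages I d g a).val.1) (x := (stages I d g a).val.2)
    (body := fun q f => complete I d g q f) fun q f => complete_steps I d g q f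
  have h4 := forBoxes_steps (g := g) (B := fullBoxes I d g a) (x := (none : Option Quad))
    (body := fun q best => better q best) fun q best => better_steps q best
  rw [← Grid.boxes] at h3 h4
  have h5 : (d.j₃ - 1 + 1 - a) * (161 * g.boxes + 1) ≤ I.n * (161 * g.boxes + 1) := by
    refine Nat.mul_le_mul_right _ ?_
    have := hd.j₃_le
    omega
  have hb := g.boxes_pos
  have h6 : 1 * g.boxes ≤ I.n * g.boxes := Nat.mul_le_mul_right _ hn
  have h7 : I.n * 1 ≤ I.n * g.boxes := Nat.mul_le_mul_left _ hb
  have h8 : I.n * (161 * g.boxes + 1) = 161 * (I.n * g.boxes) + I.n := by ring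
  omega

/-! ### Size of the grid -/

theorem logRatio_le {δ c Y : ℝ} {L U : ℕ} (hδ : 1 < δ) (hc : 0 ≤ c) (hcδ : 1 ≤ c * Real.log δ)
    (hL : 1 ≤ L) (hY : 1 ≤ Y) (hU : U ≤ Y) :
    ((logRatio (Real.log δ) L U).val : ℝ) ≤ c * Real.log Y := by
  have hl := Real.log_pos hδ
  have hYl := Real.log_nonneg hY
  rw [logRatio_val]
  have h1 : Real.log (U / L) ≤ Real.log Y := by
    rcases Nat.eq_zero_or_pos U with rfl | hU0
    · simpa using hYl
    · have hL1 : (1 : ℝ) ≤ L := by exact_mod_cast hL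
      have hU1 : (0 : ℝ) < U := by exact_mod_cast hU0
      exact Real.log_le_log (by positivity) ((div_le_self hU1.le hL1).trans hU)
  have h2 : Real.log (U / L) / Real.log δ ≤ c * Real.log Y := by
    rw [div_le_iff₀ hl]
    nlinarith
  rcases le_or_gt 0 (Real.log (U / L) / Real.log δ) with h | h
  · exact (Nat.floor_le h).trans h2
  · rw [Nat.floor_of_nonpos h.le, Nat.cast_zero]
    positivity

/-- The product of the logarithms in the bound on the running time. -/
noncomputable def logFactor (I : Problem) : ℝ :=
  Real.log (max (I.T₁ : ℝ) 2) * Real.log ((I.T₂ : ℝ) + I.totalP) *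
    Real.log ((I.wMax : ℝ) * I.totalP + (I.totalW : ℝ) * I.T₂)

theorem half_le_log {x : ℝ} (hx : 2 ≤ x) : 1 / 2 ≤ Real.log x := by
  have := Real.log_two_gt_d9
  have := Real.log_le_log two_pos hx
  linarith

theorem Problem.Valid.n_le_totalP {I : Problem} (h : I.Valid) : I.n ≤ I.totalP := by
  have := card_nsmul_le_sum I.jobs I.p 1 h.p_pos
  simpa [Problem.jobs, Problem.totalP] using this

theorem totalW_le (I : Problem) : I.totalW ≤ I.n * I.wMax := by
  have := sum_le_card_nsmul I.jobs I.w I.wMax fun i hi => le_sup (f := I.w) hi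
  simpa [Problem.jobs, Problem.totalW] using this

theorem Problem.Valid.n_le_totalW {I : Problem} (h : I.Valid) : I.n ≤ I.totalW := by
  have := card_nsmul_le_sum I.jobs I.w 1 h.w_pos
  simpa [Problem.jobs, Problem.totalW] using this

/-- The upper bound on `Z` contains `∑ w_i P_i ≤ W * P`, a product of two quantities that are each
at most `X = w_max P + W T₂`. So the upper bound is at most `X ^ 2 + X ≤ X ^ 3`, and the logarithm
grows only by a factor `3`. -/
theorem costBound_le {I : Problem} (h : I.Valid) :
    2 ≤ I.wMax * I.totalP + I.totalW * I.T₂ ∧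
    I.preZ I.n + I.preW I.n * I.T₂ ≤ (I.wMax * I.totalP + I.totalW * I.T₂) ^ 3 := by
  have hn := h.n_pos
  have hT : 1 ≤ I.T₂ := (Nat.zero_le _).trans_lt h.T₁_lt_T₂
  have hP := h.n_le_totalP
  have hW := h.n_le_totalW
  have hWm := totalW_le I
  have hwm : 1 ≤ I.wMax := by
    by_contra hc
    rw [show I.wMax = 0 by omega, mul_zero] at hWm
    omega
  have hZ : I.preZ I.n ≤ I.totalW * I.totalP := by
    rw [Problem.preZ, Problem.totalW, sum_mul]
    refine sum_le_sum fun i hi => Nat.mul_le_mul_left _ (I.pre_mono (mem_Icc.1 hi).2)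
  have hW1 : I.totalW ≤ I.wMax * I.totalP := hWm.trans (by nlinarith)
  rw [← I.totalW_eq]
  have h1 : 1 * I.totalP ≤ I.wMax * I.totalP := Nat.mul_le_mul_right _ hwm
  have h2 : 1 * 1 ≤ I.totalW * I.T₂ := Nat.mul_le_mul (hn.trans hW) hT
  set X := I.wMax * I.totalP + I.totalW * I.T₂ with hX
  have hX2 : 2 ≤ X := by omega
  refine ⟨hX2, ?_⟩
  have h3 : I.totalW * I.totalP ≤ X * X := Nat.mul_le_mul (by omega) (by omega)
  have h4 : I.totalW * I.T₂ ≤ X := by omega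
  have h5 : X * 1 ≤ X * X := Nat.mul_le_mul_left _ (by omega)
  have h6 : 2 * (X * X) ≤ X * (X * X) := Nat.mul_le_mul_right _ hX2
  have h7 : X ^ 3 = X * (X * X) := by ring
  omega

theorem boxes_le {I : Problem} {d : Prep} {a : ℕ} {ε : ℝ} (hI : I.Valid) (hd : d.Correct I)
    (ha : Admissible I a) (hε : 0 < ε) (hε1 : ε ≤ 1) :
    ((makeGrid I d ε a).val.boxes : ℝ) ≤ 672 * ((I.n / ε) ^ 3 * logFactor I) := by
  have S := setup_makeGrid hI hd ha hε
  set g := (makeGrid I d ε a).val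
  have hn : (1 : ℝ) ≤ I.n := by exact_mod_cast hI.n_pos
  obtain ⟨hX, hX3⟩ := costBound_le hI
  have hA : 1 ≤ (I.n : ℝ) / ε := by rw [one_le_div hε]; linarith
  set A : ℝ := I.n / ε with hAdef
  set x := ε / (2 * I.n) with hx
  have hx0 : 0 < x := by positivity
  have hx1 : x ≤ 1 := by rw [hx, div_le_one (by positivity)]; linarith
  have hAx : A * x = 1 / 2 := by rw [hAdef, hx]; field_simp
  -- `1 / log δ ≤ 4 n / ε`, from `log (1 + x) ≥ x / (1 + x) ≥ x / 2` and `A * x = 1 / 2`.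
  have hc : 1 ≤ 4 * A * Real.log (1 + x) := by
    have h1 := Real.one_sub_inv_le_log_of_pos (show 0 < 1 + x by linarith)
    have h2 : x / 2 ≤ 1 - (1 + x)⁻¹ := by
      rw [show 1 - (1 + x)⁻¹ = x / (1 + x) by field_simp; ring]
      gcongr
      linarith
    nlinarith
  have hT2 : (1 : ℝ) ≤ I.T₂ := by exact_mod_cast S.T₂_pos
  have hP : (1 : ℝ) ≤ I.totalP := by exact_mod_cast hI.n_pos.trans hI.n_le_totalP
  have hXr : (2 : ℝ) ≤ I.wMax * I.totalP + I.totalW * I.T₂ := by exact_mod_cast hX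
  have hX3r : ((I.preZ I.n + I.preW I.n * I.T₂ : ℕ) : ℝ) ≤
      ((I.wMax : ℝ) * I.totalP + I.totalW * I.T₂) ^ 3 := by exact_mod_cast hX3
  have hr1 : (g.r₁ : ℝ) ≤ 4 * A * Real.log (max (I.T₁ : ℝ) 2) := by
    rw [S.r₁, S.logδ]
    exact logRatio_le S.one_lt (by positivity) hc S.L₁_pos
      (one_le_two.trans (le_max_right _ _)) (le_max_left _ _)
  have hr2 : (g.r₂ : ℝ) ≤ 4 * A * Real.log ((I.T₂ : ℝ) + I.totalP) := by
    rw [S.r₂, S.logδ]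
    refine logRatio_le S.one_lt (by positivity) hc S.L₂_pos (by linarith) ?_
    rw [I.totalP_eq, Nat.cast_add]
  have hr3 : (g.r₃ : ℝ) ≤ 4 * A * (3 * Real.log ((I.wMax : ℝ) * I.totalP + I.totalW * I.T₂)) := by
    rw [S.r₃, S.logδ]
    have := logRatio_le S.one_lt (by positivity) hc S.L₃_pos (one_le_pow₀ (by linarith)) hX3r
    rwa [Real.log_pow] at this
  have k1 := half_le_log (le_max_right (I.T₁ : ℝ) 2)
  have k2 := half_le_log (show (2 : ℝ) ≤ (I.T₂ : ℝ) + I.totalP by linarith)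
  have k3 := half_le_log hXr
  rw [Grid.boxes, logFactor]
  generalize Real.log (max (I.T₁ : ℝ) 2) = l1 at *
  generalize Real.log ((I.T₂ : ℝ) + I.totalP) = l2 at *
  generalize Real.log ((I.wMax : ℝ) * I.totalP + I.totalW * I.T₂) = l3 at *
  -- As `A ≥ 1` and each logarithm is at least `1 / 2`, the additive constants `2`, `1`, `1` are at
  -- most `4 A l1`, `2 A l2`, `2 A l3`. The product of the three factors is `8 * 6 * 14 = 672`.
  have b1 : (g.r₁ : ℝ) + 2 ≤ 8 * A * l1 := by nlinarith
  have b2 : (g.r₂ : ℝ) + 1 ≤ 6 * A * l2 := by nlinarith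
  have b3 : (g.r₃ : ℝ) + 1 ≤ 14 * A * l3 := by nlinarith
  push_cast
  calc ((g.r₁ : ℝ) + 2) * (g.r₂ + 1) * (g.r₃ + 1) ≤ (8 * A * l1) * (6 * A * l2) * (14 * A * l3) := by
        gcongr
    _ = _ := by ring

/-! ### The whole algorithm -/

/-- The treatment of one candidate `a` for the first late job. -/
noncomputable def tryFirst (I : Problem) (d : Prep) (ε : ℝ) (a : ℕ) (best : Option Quad) :
    Timed (Option Quad) := do
  let a' ← subN a 1
  let Sa ← readA d.P a'
  let Sk ← addN Sa I.k
  let ok ← leN I.T₂ Sk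
  if ok then do
    let res ← approxAt I d ε a
    match res with
    | none => pure best
    | some q => better q best
  else pure best

/-- The best quadruple over all candidates for the first late job. -/
noncomputable def bestQuad (I : Problem) (d : Prep) (ε : ℝ) : Timed (Option Quad) :=
  forRange 1 d.j₁ (none : Option Quad) fun a best => tryFirst I d ε a best

section

variable {I : Problem} {d : Prep} {a : ℕ} {ε V : ℝ}

theorem tryFirst_val (hd : d.Correct I) (ha : a ≤ I.n) (best : Option Quad) :
    (tryFirst I d ε a best).val = if I.T₂ ≤ I.pre (a - 1) + I.k then
      ((approxAt I d ε a).val.elim best fun q => (better q best).val) else best := by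
  simp only [tryFirst, bind_val, subN, readA, addN, leN, hd.P _ (show a - 1 ≤ I.n by omega)]
  by_cases h : I.T₂ ≤ I.pre (a - 1) + I.k
  · simp only [h, decide_true, if_true, bind_val]
    cases (approxAt I d ε a).val <;> rfl
  · simp [h]

theorem isSchedule_tryFirst (hI : I.Valid) (hd : d.Correct I) (hε : 0 < ε) (h1 : 1 ≤ a)
    (h2 : a ≤ d.j₁) {best : Option Quad} (hb : IsSchedule I best) :
    IsSchedule I (tryFirst I d ε a best).val := by
  have hn := h2.trans hd.j₁_le
  rw [tryFirst_val hd hn]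
  split_ifs with hk
  · have S := setup_makeGrid hI hd ⟨h1, hn, (hd.le_j₁_iff a h1 hn).1 h2, hk⟩ hε
    have := isSchedule_approxAt S
    cases hv : (approxAt I d ε a).val with
    | none => exact hb
    | some q => exact hb.better (this q hv)
  · exact hb

theorem isSchedule_bestQuad (hI : I.Valid) (hd : d.Correct I) (hε : 0 < ε) :
    IsSchedule I (bestQuad I d ε).val :=
  forRange_inv (fun _ => IsSchedule I) (fun q h => by simp at h)
    fun _ _ h1 h2 hb => isSchedule_tryFirst hI hd hε h1 h2 hb

/-- The first late job of the reference is among the candidates tried, and later candidates can only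
improve the result. -/
theorem atMost_bestQuad (hI : I.Valid) (hd : d.Correct I) (hε : 0 < ε) {L : Finset ℕ}
    (ha : Admissible I a) (R : Reference I L a V) :
    AtMost ((1 + ε / (2 * I.n)) ^ I.n * V) (bestQuad I d ε).val := by
  refine forRange_reach (i₀ := a) (fun _ => True) (AtMost _) ha.pos
    ((hd.le_j₁_iff a ha.pos ha.le).2 ha.pre_le) trivial (fun _ _ _ _ _ => trivial) (fun o _ => ?_)
    fun i o h1 h2 _ ho => ?_
  · rw [tryFirst_val hd ha.le, if_pos ha.dev_le]
    obtain ⟨q, hq, hZ⟩ := atMost_approxAt (setup_makeGrid hI hd ha hε) R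
    rw [hq]
    exact atMost_better o hZ
  · rw [tryFirst_val hd (h2.trans hd.j₁_le)]
    split_ifs
    · cases (approxAt I d ε i).val with
      | none => exact ho
      | some q => exact ho.better q
    · exact ho

theorem tryFirst_steps (hI : I.Valid) (hd : d.Correct I) (hε : 0 < ε) (hε1 : ε ≤ 1) (h1 : 1 ≤ a)
    (h2 : a ≤ d.j₁) {M : ℕ} (hM : 672 * ((I.n / ε) ^ 3 * logFactor I) ≤ M) (best : Option Quad) :
    (tryFirst I d ε a best).steps ≤ 5 + 400 * (I.n * M) := by
  have hn := h2.trans hd.j₁_le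
  simp only [tryFirst, bind_steps, subN, readA, addN, leN,
    hd.P _ (show a - 1 ≤ I.n by omega)]
  by_cases hk : I.T₂ ≤ I.pre (a - 1) + I.k
  · have hb := boxes_le hI hd ⟨h1, hn, (hd.le_j₁_iff a h1 hn).1 h2, hk⟩ hε hε1
    have hb' : (makeGrid I d ε a).val.boxes ≤ M := by exact_mod_cast hb.trans hM
    have hs := approxAt_steps hd hI.n_pos ε a
    have := Nat.mul_le_mul_left I.n hb'
    simp only [hk, decide_true, if_true, bind_steps]
    cases (approxAt I d ε a).val with
    | none => simp only [pure_steps]; omega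
    | some q => have := better_steps q best; simp only; omega
  · simp only [hk, decide_false, Bool.false_eq_true, if_false, pure_steps]
    omega

theorem bestQuad_steps (hI : I.Valid) (hd : d.Correct I) (hε : 0 < ε) (hε1 : ε ≤ 1)
    {M : ℕ} (hM : 672 * ((I.n / ε) ^ 3 * logFactor I) ≤ M) :
    (bestQuad I d ε).steps ≤ I.n * (6 + 400 * (I.n * M)) + 1 := by
  have := forRange_steps (lo := 1) (hi := d.j₁) (x := (none : Option Quad))
    (body := fun a best => tryFirst I d ε a best)
    fun a best h1 h2 => tryFirst_steps hI hd hε hε1 h1 h2 hM best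
  refine this.trans (Nat.add_le_add_right (Nat.mul_le_mul ?_ (by omega)) 1)
  have := hd.j₁_le
  omega

end

theorem approx_val_steps {I : Problem} {ε : ℝ} {q : Quad}
    (h : (bestQuad I (preprocess I).val ε).val = some q) :
    (approx I ε).val = some (backtrack I q.blocks fun _ => 0).val ∧
    (approx I ε).steps = (preprocess I).steps + ((bestQuad I (preprocess I).val ε).steps +
      (1 + ((I.n + 1) + (backtrack I q.blocks fun _ => 0).steps))) := by
  have e : approx I ε = (do
      let d ← preprocess I
      let best ← bestQuad I d ε
      match best with
      | none => pure none
      | some q => do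
        let size ← addN I.n 1
        let A ← newArr size
        let σ ← backtrack I q.blocks A
        pure (some σ)) := rfl
  rw [e]
  simp only [bind_val, bind_steps, h]
  exact ⟨rfl, rfl⟩

theorem one_add_div_pow_le {ε : ℝ} {n : ℕ} (hn : 1 ≤ n) (hε : 0 < ε) (hε1 : ε ≤ 1) :
    (1 + ε / (2 * n)) ^ n ≤ 1 + ε := by
  have hn0 : (0 : ℝ) < n := by exact_mod_cast hn
  have h1 : (1 + ε / (2 * n)) ^ n ≤ Real.exp (ε / 2) := by
    calc (1 + ε / (2 * n)) ^ n ≤ Real.exp (ε / (2 * n)) ^ n := by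
          gcongr
          linarith [Real.add_one_le_exp (ε / (2 * n))]
      _ = Real.exp (ε / 2) := by
          rw [← Real.exp_nat_mul]
          congr 1
          field_simp
  -- `exp (-ε/2) ≥ 1 - ε/2` gives `exp (ε/2) ≤ 1 / (1 - ε/2)`, and `(1 + ε)(1 - ε/2) ≥ 1` for `ε ≤
  -- 1`.
  have h2 := Real.add_one_le_exp (-(ε / 2))
  have h3 : Real.exp (ε / 2) * Real.exp (-(ε / 2)) = 1 := by rw [← Real.exp_add]; simp
  nlinarith [Real.exp_pos (ε / 2)]

end Resched

/-! ### Approximation ratio and running time combined -/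

theorem corollary4p1 :
    ∃ C : ℝ, 0 < C ∧ ∀ (I : Resched.Problem) (ε : ℝ), I.Valid → 0 < ε → ε ≤ 1 →
      (∃ σ : ℕ → ℕ, (Resched.approx I ε).val = some σ ∧
        I.Feasible (fun j => (σ j : ℝ)) ∧
        ∀ τ : ℕ → ℝ, I.Feasible τ →
          I.objective (fun j => (σ j : ℝ)) ≤ (1 + ε) * I.objective τ) ∧
      ((Resched.approx I ε).steps : ℝ) ≤
        C * ((I.n : ℝ) ^ 5 / ε ^ 3 * Real.log (max (I.T₁ : ℝ) 2) *
          Real.log ((I.T₂ : ℝ) + I.totalP) *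
          Real.log ((I.wMax : ℝ) * I.totalP + (I.totalW : ℝ) * I.T₂)) := by
  -- The constant covers `600 * 1344`: the factor `600` for the steps per `n ^ 2 * M`, and `M ≤ 1344
  -- * F`.
  refine ⟨1000000, by norm_num, fun I ε hI hε hε1 => ?_⟩
  have hd := Resched.preprocess_correct hI
  have hn := hI.n_pos
  obtain ⟨L₀, a₀, V₀, ha₀, R₀⟩ := Resched.exists_reference hI
  obtain ⟨q, hq, -⟩ := Resched.atMost_bestQuad hI hd hε ha₀ R₀
  obtain ⟨hreal, hlen⟩ := Resched.isSchedule_bestQuad hI hd hε q hq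
  obtain ⟨hval, hsteps⟩ := Resched.approx_val_steps hq
  obtain ⟨hfeas, hobj⟩ := hreal.feasible fun _ => 0
  refine ⟨⟨_, hval, hfeas, fun τ hτ => ?_⟩, ?_⟩
  · obtain ⟨L, a, ha, R⟩ := Resched.exists_reference_of_feasible hI hτ
    obtain ⟨q', hq', hZ⟩ := Resched.atMost_bestQuad hI hd hε ha R
    rw [hq, Option.some_inj] at hq'
    subst hq'
    rw [hobj]
    exact hZ.trans (mul_le_mul_of_nonneg_right (Resched.one_add_div_pow_le hn hε hε1)
      (le_trans (by positivity) (R.cost 0 (Nat.zero_le _))))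
  · set F : ℝ := (I.n / ε) ^ 3 * Resched.logFactor I with hF
    have hnr : (1 : ℝ) ≤ I.n := by exact_mod_cast hn
    -- The grid for `a₀` has at least one box, so the bound on the number of boxes is itself at
    -- least `1`. This absorbs the rounding in `M`.
    have hF1 : 1 ≤ 672 * F :=
      le_trans (by exact_mod_cast Resched.Grid.boxes_pos _) (Resched.boxes_le hI hd ha₀ hε hε1)
    have hM := Nat.le_ceil (672 * F)
    have hM' := Nat.ceil_lt_add_one (zero_le_one.trans hF1)
    set M := ⌈672 * F⌉₊ with hMdef
    have hM1 : 1 ≤ M := by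
      have : (1 : ℝ) ≤ M := hF1.trans hM
      exact_mod_cast this
    have s1 := Resched.preprocess_steps I
    have s2 := Resched.bestQuad_steps hI hd hε hε1 hM
    have s3 := Resched.backtrack_steps (I := I) q.blocks hreal.2.1 fun _ => 0
    -- Uses `n + 3 ≤ 4 n` and `4 n + 3 ≤ 7 n`.
    have s4 : q.blocks.length * (4 * I.n + 3) ≤ (4 * I.n) * (7 * I.n) :=
      Nat.mul_le_mul (by omega) (by omega)
    have t1 : I.n * 1 ≤ I.n * I.n := Nat.mul_le_mul_left _ hn
    have t2 : I.n * I.n * 1 ≤ I.n * I.n * M := Nat.mul_le_mul_left _ hM1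
    have t3 : I.n * (6 + 400 * (I.n * M)) = 6 * I.n + 400 * (I.n * I.n * M) := by ring
    have t4 : (4 * I.n) * (7 * I.n) = 28 * (I.n * I.n) := by ring
    have total : (Resched.approx I ε).steps ≤ 600 * (I.n * I.n * M) := by
      rw [hsteps]
      omega
    have total' : ((Resched.approx I ε).steps : ℝ) ≤ 600 * (I.n * I.n * M) := by exact_mod_cast total
    have hMF : (M : ℝ) ≤ 1344 * F := by linarith
    have key : (I.n : ℝ) ^ 5 / ε ^ 3 * Real.log (max (I.T₁ : ℝ) 2) *
          Real.log ((I.T₂ : ℝ) + I.totalP) *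
          Real.log ((I.wMax : ℝ) * I.totalP + (I.totalW : ℝ) * I.T₂) = I.n * I.n * F := by
      rw [hF, Resched.logFactor, div_pow]
      ring
    rw [key]
    have hnn : (0 : ℝ) ≤ I.n * I.n := by positivity
    nlinarith [mul_le_mul_of_nonneg_left hMF hnn, mul_nonneg hnn (show (0 : ℝ) ≤ F by linarith)]
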